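/- **Setting.** Let $\mathcal S$ be a complete separable metric space and let $X(t)$, $t\ge 0$, be a homogeneous strong Markov process with values in $\mathcal S$ and right-continuous sample paths, with laws $\mathbb P_x$, $x\in\mathcal S$, such that $P_t h(x)=\mathbb E_x[h(X(t))]$ is in $C_b(\mathcal S)$ for every $h\in C_b(\mathcal S)$. Let $D(P)=\{h\in C_b(\mathcal S): \|P_t h-h\|_\infty\to 0 \text{ as } t\downarrow 0\}$ and let $L$, with domain $D(L)\subseteq D(P)$, be the generator: $h\in D(L)$ and $Lh=k$ if $h,k\in D(P)$ and $\|t^{-1}(P_th-h)-k\|_\infty\to 0$ as $t\downarrow 0$. Assume that $D(P)$ is an algebra under pointwise multiplication and is dense in $L_2(\mu)$ for every probability measure $\mu$ on $\mathcal S$. Let $\mathcal G\subseteq D(L)$ be a linear space and an algebra with $\mathbf 1\in\mathcal G$, dense in $(D(P),\|\cdot\|_\infty)$, put $\widehat{\mathcal G}=\{P_tg: g\in\mathcal G,\ t\ge 0\}$, and assume that $\phi(g)\in\mathcal G$, $Lg\in\mathcal G$ and $g\hat h\in D(L)$ for all $g\in\mathcal G$, $\hat h\in\widehat{\mathcal G}$,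 $\phi\in C^\infty(\mathbb R)$. Let $\mu^0$ be an invariant probability measure for $P_t$. For $f\in\mathcal G$ let $$t^f(s)=\int_0^s e^{f(X(u))}\,du,\qquad \tau^f(t)=\inf\{s\ge 0: t^f(s)\ge t\},\qquad X_0^f(t)=X(\tau^f(t)),$$ and $P^f_th(x)=\mathbb E_x[h(X_0^f(t))]$. For $f\in\mathcal G$ let $A_f=-fL$, with domain $D(L)$. **Theorem 4.1.** The family $X^f_0$, $f\in\mathcal G$, is a Markovian perturbation of $X$ which has, with respect to the supremum norm on $C_b(\mathcal S)$, the response function $$R(s,t)=P_sA_fP_{t-s}g,\qquad A_f=-fL .$$ Explicitly: 1. $X_0^0=X$. For each $f\in\mathcal G$, $X_0^f$ is a homogeneous Markov process started at $x$ under $\mathbb P_x$; $P^f_t$ is a semi-group on $C_b(\mathcal S)$-functions in the sense that $P^f_{s+t}h=P^f_s(P^f_th)$ and $\|P^f_th\|_\infty\le\|h\|_\infty$ for $h\in C_b(\mathcal S)$; it maps $D(P)$ to itself and $\|P^f_th-h\|_\infty\to0$ as $t\downarrow0$ for $h\in D(P)$; the finite measure $\mu^f$ with $d\mu^f/d\mu^0=e^f$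 is invariant for $P^f_t$; and for each $g\in\mathcal G$ the quotient $t^{-1}(P^f_tg-g)$ converges uniformly, as $t\downarrow0$, to an element of $\mathcal G$. 2. For each $f\in\mathcal G$: the domain of $A_f$ contains $\widehat{\mathcal G}$; for each $g\in\mathcal G$ the map $s\mapsto A_fP_sg$ is continuous from $[0,\infty)$ to $(C_b(\mathcal S),\|\cdot\|_\infty)$; and for each $\hat g\in\widehat{\mathcal G}$ and $t\ge0$ the map $s\mapsto P_sA_fP_{t-s}\hat g$ is strongly integrable on $[0,t]$. 3. For all $f\in\mathcal G$, $\hat g\in\widehat{\mathcal G}$ and $T\ge0$ there are numbers $\eta_\delta=\eta_\delta(f,\hat g,T)$ with $\eta_\delta\to0$ as $\delta\downarrow0$ such that, for all $\delta>0$ and $t\in[0,T]$, $$\Big\|\delta^{-1}\big(P^{\delta f}_t-P_t\big)\hat g-\int_0^tP_sA_fP_{t-s}\hat g\,ds\Big\|_\infty\le\eta_\delta\,t .$$ -/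

import Mathlib

open MeasureTheory ProbabilityTheory Filter Topology Set
open scoped NNReal ENNReal BoundedContinuousFunction

noncomputable section

namespace TimeChange

/-- The information available up to time `t`: the `σ`-algebra generated by `X u`, `u ≤ t`. -/
@[reducible] def history {S Ω : Type*} [MeasurableSpace S] (X : ℝ≥0 → Ω → S) (t : ℝ≥0) : MeasurableSpace Ω :=
  ⨆ u ∈ Iic t, MeasurableSpace.comap (X u) inferInstance

/-- Finite stopping times of the canonical filtration of `X`. -/
def IsFiniteStoppingTime {S Ω : Type*} [MeasurableSpace S] (X : ℝ≥0 → Ω → S) (τ : Ω → ℝ≥0) : Prop :=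
  ∀ t, MeasurableSet[history X t] {ω | τ ω ≤ t}

/-- Membership in the `σ`-algebra of events prior to the finite time `τ`. -/
def IsPriorEvent {S Ω : Type*} [MeasurableSpace S] (X : ℝ≥0 → Ω → S) (τ : Ω → ℝ≥0)
    (A : Set Ω) : Prop :=
  ∀ t, MeasurableSet[history X t] (A ∩ {ω | τ ω ≤ t})

/-- A homogeneous strong Markov process with right continuous sample paths, whose semi-group
`h ↦ E_x (h (X t))` maps bounded continuous functions to continuous functions.
`P x` is the law on `Ω` for the process started at `x`. -/
structure StrongMarkovProcess (S Ω : Type*) [TopologicalSpace S] [MeasurableSpace S]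
    [MeasurableSpace Ω] where
  X : ℝ≥0 → Ω → S
  P : Kernel S Ω
  isMarkovKernel : IsMarkovKernel P
  measurable_X : ∀ t, Measurable (X t)
  start : ∀ x, ∀ᵐ ω ∂(P x), X 0 ω = x
  rightContinuous : ∀ ω t, ContinuousWithinAt (fun u => X u ω) (Ici t) t
  strongMarkov : ∀ (x : S) (τ : Ω → ℝ≥0), IsFiniteStoppingTime X τ →
    ∀ A : Set Ω, IsPriorEvent X τ A → ∀ B : Set (ℝ≥0 → S), MeasurableSet B →
      P x (A ∩ {ω | (fun t => X (τ ω + t) ω) ∈ B})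
        = ∫⁻ ω in A, P (X (τ ω) ω) {ω' | (fun t => X t ω') ∈ B} ∂(P x)
  feller : ∀ (t : ℝ≥0) (h : S →ᵇ ℝ), Continuous fun x => ∫ ω, h (X t ω) ∂(P x)

/-- For a one-parameter family of linear maps `T t`, `t ≥ 0`, the subspace of those `h` with
`T t h → h` as `t ↓ 0`. -/
def strongDomain {E : Type*} [NormedAddCommGroup E] [NormedSpace ℝ E] (T : ℝ≥0 → E →ₗ[ℝ] E) :
    Submodule ℝ E where
  carrier := {h | Tendsto (fun t => T t h) (𝓝[>] 0) (𝓝 h)}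
  add_mem' := by
    intro a b ha hb
    simpa using Tendsto.add ha hb
  zero_mem' := by simp
  smul_mem' := by
    intro c a ha
    simpa using Tendsto.const_smul ha c

/-- `h` and `k` lie in the strong domain of `T` and `t⁻¹ (T t h - h) → k` as `t ↓ 0`. -/
def IsGeneratorPair {E : Type*} [NormedAddCommGroup E] [NormedSpace ℝ E] (T : ℝ≥0 → E →ₗ[ℝ] E)
    (h k : E) : Prop :=
  h ∈ strongDomain T ∧ k ∈ strongDomain T ∧
    Tendsto (fun t : ℝ≥0 => (t : ℝ)⁻¹ • (T t h - h)) (𝓝[>] 0) (𝓝 k)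

section generatorFacts

variable {E : Type*} [NormedAddCommGroup E] [NormedSpace ℝ E] {T : ℝ≥0 → E →ₗ[ℝ] E}

theorem IsGeneratorPair.unique {h k k' : E} (H : IsGeneratorPair T h k)
    (H' : IsGeneratorPair T h k') : k = k' :=
  tendsto_nhds_unique H.2.2 H'.2.2

theorem IsGeneratorPair.add {h k h' k' : E} (H : IsGeneratorPair T h k)
    (H' : IsGeneratorPair T h' k') : IsGeneratorPair T (h + h') (k + k') := by
  refine ⟨add_mem H.1 H'.1, add_mem H.2.1 H'.2.1, ?_⟩
  refine (H.2.2.add H'.2.2).congr fun t => ?_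
  rw [map_add, ← smul_add]
  congr 1
  abel

theorem IsGeneratorPair.smul {h k : E} (c : ℝ) (H : IsGeneratorPair T h k) :
    IsGeneratorPair T (c • h) (c • k) := by
  refine ⟨Submodule.smul_mem _ c H.1, Submodule.smul_mem _ c H.2.1, ?_⟩
  refine (H.2.2.const_smul c).congr fun t => ?_
  rw [map_smul, ← smul_sub, smul_comm]

theorem IsGeneratorPair.zero : IsGeneratorPair T 0 0 := by
  refine ⟨zero_mem _, zero_mem _, ?_⟩
  simp

end generatorFacts

/-- The (infinitesimal) generator of the family `T`, as an unbounded linear operator. -/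
def generator {E : Type*} [NormedAddCommGroup E] [NormedSpace ℝ E] (T : ℝ≥0 → E →ₗ[ℝ] E) :
    E →ₗ.[ℝ] E where
  domain :=
    { carrier := {h | ∃ k, IsGeneratorPair T h k}
      add_mem' := fun ⟨_, H⟩ ⟨_, H'⟩ => ⟨_, H.add H'⟩
      zero_mem' := ⟨0, IsGeneratorPair.zero⟩
      smul_mem' := fun c _ ⟨_, H⟩ => ⟨_, H.smul c⟩ }
  toFun :=
    { toFun := fun h => h.2.choose
      map_add' := fun a b =>
        (a + b).2.choose_spec.unique (a.2.choose_spec.add b.2.choose_spec)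
      map_smul' := fun c a => (c • a).2.choose_spec.unique (a.2.choose_spec.smul c) }

/-- The value of a partially defined operator, extended by `0` outside its domain. -/
def applyOrZero {E : Type*} [NormedAddCommGroup E] [NormedSpace ℝ E] (A : E →ₗ.[ℝ] E) (h : E) : E :=
  open Classical in if hh : h ∈ A.domain then A ⟨h, hh⟩ else 0

namespace StrongMarkovProcess

variable {S Ω : Type*} [TopologicalSpace S] [MeasurableSpace S] [MeasurableSpace Ω]

/-- The expectation `E_x (h (Y t))`, as a function of `x`, for a process `Y` defined on the same
space as the given process. -/
def expect (M : StrongMarkovProcess S Ω) (Y : ℝ≥0 → Ω → S) (t : ℝ≥0) (h : S → ℝ) (x : S) : ℝ :=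
  ∫ ω, h (Y t ω) ∂(M.P x)

theorem abs_expect_le (M : StrongMarkovProcess S Ω) (Y : ℝ≥0 → Ω → S) (t : ℝ≥0) (h : S →ᵇ ℝ)
    (x : S) : ‖M.expect Y t h x‖ ≤ ‖h‖ := by
  have := M.isMarkovKernel
  have := norm_integral_le_of_norm_le_const (μ := M.P x) (f := fun ω => h (Y t ω)) (C := ‖h‖)
    (Eventually.of_forall fun ω => h.norm_coe_le_norm _)
  simpa [expect] using this

variable [OpensMeasurableSpace S]

theorem integrable_comp (M : StrongMarkovProcess S Ω) (t : ℝ≥0) (h : S →ᵇ ℝ) (x : S) :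
    Integrable (fun ω => h (M.X t ω)) (M.P x) := by
  have := M.isMarkovKernel
  exact Integrable.of_bound
    (h.continuous.measurable.comp (M.measurable_X t)).aestronglyMeasurable ‖h‖
    (Eventually.of_forall fun ω => h.norm_coe_le_norm _)

/-- The Markov semi-group on `C_b(S)`: `semigroup t h x = E_x (h (X t))`. -/
def semigroup (M : StrongMarkovProcess S Ω) (t : ℝ≥0) : (S →ᵇ ℝ) →ₗ[ℝ] (S →ᵇ ℝ) where
  toFun h := BoundedContinuousFunction.ofNormedAddCommGroup (M.expect M.X t h) (M.feller t h) ‖h‖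
    (M.abs_expect_le M.X t h)
  map_add' h k := by
    ext x
    exact integral_add (M.integrable_comp t h x) (M.integrable_comp t k x)
  map_smul' c h := by
    ext x
    exact integral_const_mul c _

/-- The space `D(P)` of bounded continuous functions on which the semi-group is strongly
continuous. -/
def D (M : StrongMarkovProcess S Ω) : Submodule ℝ (S →ᵇ ℝ) := strongDomain M.semigroup

/-- The generator `L` of the semi-group. -/
def L (M : StrongMarkovProcess S Ω) : (S →ᵇ ℝ) →ₗ.[ℝ] (S →ᵇ ℝ) := generator M.semigroup

/-- The set `{P_t g : g ∈ G, t ≥ 0}`. -/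
def hat (M : StrongMarkovProcess S Ω) (G : Subalgebra ℝ (S →ᵇ ℝ)) : Set (S →ᵇ ℝ) :=
  {k | ∃ g ∈ G, ∃ t : ℝ≥0, k = M.semigroup t g}

/-- A finite measure `μ` is invariant for the process `Y`. -/
def IsInvariant (M : StrongMarkovProcess S Ω) (Y : ℝ≥0 → Ω → S) (μ : Measure S) : Prop :=
  IsFiniteMeasure μ ∧ ∀ (h : S → ℝ), Measurable h → (∃ C, ∀ x, |h x| ≤ C) →
    ∀ t, ∫ x, M.expect Y t h x ∂μ = ∫ x, h x ∂μ

/-- The standing assumptions on the process and on the algebra `G` of test functions. -/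
structure IsTestAlgebra [BorelSpace S] [PolishSpace S] (M : StrongMarkovProcess S Ω)
    (G : Subalgebra ℝ (S →ᵇ ℝ)) : Prop where
  mul_mem_D : ∀ h ∈ M.D, ∀ k ∈ M.D, h * k ∈ M.D
  dense_L2 : ∀ (μ : Measure S) [IsProbabilityMeasure μ],
    Dense ((fun h : S →ᵇ ℝ => BoundedContinuousFunction.toLp 2 μ ℝ h) '' (M.D : Set (S →ᵇ ℝ)))
  le_domain : ∀ g ∈ G, g ∈ M.L.domain
  dense_D : (M.D : Set (S →ᵇ ℝ)) ⊆ closure (G : Set (S →ᵇ ℝ))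
  smooth_comp_mem : ∀ g ∈ G, ∀ φ : ℝ → ℝ, ContDiff ℝ ((⊤ : ℕ∞) : WithTop ℕ∞) φ → ∃ k ∈ G, ∀ x, k x = φ (g x)
  L_mem : ∀ g ∈ G, ∃ k ∈ G, (g, k) ∈ M.L.graph
  mul_hat_mem : ∀ g ∈ G, ∀ k ∈ M.hat G, g * k ∈ M.L.domain

/-- The clock `t^f(s) = ∫₀ˢ exp (f (X u)) du`. -/
def clock (M : StrongMarkovProcess S Ω) (f : S →ᵇ ℝ) (s : ℝ≥0) (ω : Ω) : ℝ :=
  ∫ u in (0 : ℝ)..s, Real.exp (f (M.X u.toNNReal ω))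

/-- The inverse clock `τ^f(t) = inf {s ≥ 0 : t^f(s) ≥ t}`. -/
def inverseClock (M : StrongMarkovProcess S Ω) (f : S →ᵇ ℝ) (t : ℝ≥0) (ω : Ω) : ℝ≥0 :=
  sInf {s : ℝ≥0 | (t : ℝ) ≤ M.clock f s ω}

/-- The time-changed process `X₀^f(t) = X(τ^f(t))`. -/
def timeChanged (M : StrongMarkovProcess S Ω) (f : S →ᵇ ℝ) (t : ℝ≥0) (ω : Ω) : S :=
  M.X (M.inverseClock f t ω) ω

/-- The family of processes `Y f`, `f ∈ G`, is a Markovian perturbation of the given process on the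
space of test functions `G`, for the supremum norm: `Y 0` is the given process, each `Y f` is
a homogeneous Markov process whose semi-group is contractive for the supremum norm, preserves
`D(P)` and is strongly continuous there, has `exp (f) μ₀` as invariant measure, and has a
generator which is defined on `G` and maps `G` to `G`. -/
structure IsMarkovPerturbation (M : StrongMarkovProcess S Ω) (G : Subalgebra ℝ (S →ᵇ ℝ))
    (μ₀ : Measure S) (Y : (S →ᵇ ℝ) → ℝ≥0 → Ω → S) : Prop where
  zero : Y 0 = M.X
  measurable : ∀ f ∈ G, ∀ t, Measurable (Y f t)
  start : ∀ f ∈ G, ∀ x, ∀ᵐ ω ∂(M.P x), Y f 0 ω = x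
  markov : ∀ f ∈ G, ∀ (x : S) (s t : ℝ≥0) (A : Set Ω), MeasurableSet[history (Y f) s] A →
    ∀ B : Set S, MeasurableSet B →
      M.P x (A ∩ {ω | Y f (s + t) ω ∈ B})
        = ∫⁻ ω in A, M.P (Y f s ω) {ω' | Y f t ω' ∈ B} ∂(M.P x)
  semigroup_add : ∀ f ∈ G, ∀ (s t : ℝ≥0) (h : S →ᵇ ℝ) (x : S),
    M.expect (Y f) (s + t) h x = M.expect (Y f) s (M.expect (Y f) t h) x
  contractive : ∀ f ∈ G, ∀ (t : ℝ≥0) (h : S →ᵇ ℝ) (x : S), |M.expect (Y f) t h x| ≤ ‖h‖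
  map_D : ∀ f ∈ G, ∀ (t : ℝ≥0), ∀ h ∈ M.D, ∃ k ∈ M.D, ∀ x, k x = M.expect (Y f) t h x
  strongCont : ∀ f ∈ G, ∀ h ∈ M.D,
    TendstoUniformly (fun (t : ℝ≥0) x => M.expect (Y f) t h x) h (𝓝[>] 0)
  invariant : ∀ f ∈ G,
    M.IsInvariant (Y f) (μ₀.withDensity fun x => ENNReal.ofReal (Real.exp (f x)))
  generator : ∀ f ∈ G, ∀ g ∈ G, ∃ k ∈ G,
    TendstoUniformly (fun (t : ℝ≥0) x => (t : ℝ)⁻¹ * (M.expect (Y f) t g x - g x)) k (𝓝[>] 0)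

/-- The function `P_s A P_{t-s} g`, for real `0 ≤ s ≤ t`. -/
def response (M : StrongMarkovProcess S Ω) (A : (S →ᵇ ℝ) →ₗ.[ℝ] (S →ᵇ ℝ)) (g : S →ᵇ ℝ) (s t : ℝ) :
    S →ᵇ ℝ :=
  M.semigroup s.toNNReal (applyOrZero A (M.semigroup (t - s).toNNReal g))

/-- The family `Y` is a Markovian perturbation of the given process which has the response function
`(s, t) ↦ P_s A_f P_{t-s} g` in the Banach space `C_b(S)` with the supremum norm. -/
structure HasResponseFunction (M : StrongMarkovProcess S Ω) (G : Subalgebra ℝ (S →ᵇ ℝ))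
    (μ₀ : Measure S) (Y : (S →ᵇ ℝ) → ℝ≥0 → Ω → S)
    (A : (S →ᵇ ℝ) → (S →ᵇ ℝ) →ₗ.[ℝ] (S →ᵇ ℝ)) : Prop where
  perturbation : M.IsMarkovPerturbation G μ₀ Y
  hat_subset_domain : ∀ f ∈ G, ∀ k ∈ M.hat G, k ∈ (A f).domain
  continuous : ∀ f ∈ G, ∀ g ∈ G,
    Continuous fun s : ℝ≥0 => applyOrZero (A f) (M.semigroup s g)
  integrable : ∀ f ∈ G, ∀ k ∈ M.hat G, ∀ t : ℝ≥0,
    IntervalIntegrable (fun s => M.response (A f) k s t) volume 0 t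
  bound : ∀ f ∈ G, ∀ k ∈ M.hat G, ∀ T : ℝ≥0, ∃ η : ℝ → ℝ, Tendsto η (𝓝[>] 0) (𝓝 0) ∧
    ∀ δ : ℝ, 0 < δ → ∀ t : ℝ≥0, t ≤ T → ∀ x : S,
      |δ⁻¹ * (M.expect (Y (δ • f)) t k x - M.semigroup t k x)
        - (∫ s in (0 : ℝ)..t, M.response (A f) k s t) x| ≤ η δ * t

/-- The operator `- f L`, with domain that of `L`. -/
def negMulL (M : StrongMarkovProcess S Ω) (f : S →ᵇ ℝ) : (S →ᵇ ℝ) →ₗ.[ℝ] (S →ᵇ ℝ) :=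
  (LinearMap.mulLeft ℝ (-f)).compPMap M.L

end StrongMarkovProcess

end TimeChange

end

/-! Write A = e^{-f}L. The clock is a cocycle: reaching level s + t takes the time to reach s, then
the time in which the shifted path gains t. With the strong Markov property at `inverseClock f s`
this makes X₀^f Markov. Dynkin's formula for X up to the inverse clock, with its integral rewritten
in the new time, reads P^f_t u - u = ∫₀ᵗ P^f_r A u dr for u ∈ D(L) (`expect_timeChanged_sub`). Hence
orbits of D(L) are Lipschitz in time uniformly in x, density gives strong continuity on D(P), and A
acts as the generator of P^f on D(L).

That P^f_t preserves D(P), or even continuity in x, cannot be read off the paths. It comes from the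
resolvent. The equation u - δAu = h is equivalent to cu - δLu = (c - e^f)u + e^f h with c = e^{‖f‖},
which Banach's fixed point theorem solves in D(P) (`exists_isResolvent`). The backward Euler
iterates (1 - (t/n)A)^{-n} g converge uniformly to P^f_t g for g ∈ G (`InSquareDomain.exists_near`).
Whatever resolvents preserve and uniform limits respect is therefore inherited by P^f_t. This
applies to membership in D(P), and to the integral against e^f μ₀, because ∫ e^f Au dμ₀ = ∫ Lu dμ₀ =
0. Density in L₂ then extends invariance from D(P) to all bounded measurable functions.

The response estimate rests on Duhamel's formula P^f_t k - P_t k = ∫₀ᵗ P^f_s (e^{-f} - 1) P_{t-s} Lk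
ds (`expect_sub_semigroup_eq_integral`). For δf in place of f, the factor (e^{-δf} - 1)/δ tends
uniformly to -f. Moreover P^{δf}_s → P_s uniformly for s ≤ T on the compact family {f P_r Lk : r ≤
T}, which is Duhamel's formula again together with density. Both errors sit under an integral over
[0, t], whence the bound η_δ t. -/

noncomputable section

namespace TimeChange

/-! ### Right-continuous paths: joint measurability and right derivatives of integrals. -/

section RightContinuousPaths

/-- Right continuity of a path at every time. -/
def IsRightContinuousPath {S : Type*} [TopologicalSpace S] (p : ℝ≥0 → S) : Prop :=
  ∀ t, ContinuousWithinAt p (Ici t) t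

/-- Right continuous paths, with the `σ`-algebra generated by the coordinates. -/
abbrev RightPath (S : Type*) [TopologicalSpace S] := {p : ℝ≥0 → S // IsRightContinuousPath p}

variable {S Ω : Type*} [TopologicalSpace S]

/-- The added 1 pushes the grid point beyond u, so the approximation comes from the right, where the
paths are continuous. -/
theorem tendsto_floor_mul_add_one_div (u : ℝ≥0) :
    Tendsto (fun n : ℕ => ((⌊u * (n + 1 : ℝ≥0)⌋₊ : ℝ≥0) + 1) / (n + 1)) atTop (𝓝[Ici u] u) := by
  refine tendsto_nhdsWithin_iff.2 ⟨?_, Eventually.of_forall fun n => ?_⟩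
  · have h0 : Tendsto (fun n : ℕ => (1 : ℝ≥0) / ((n : ℝ≥0) + 1)) atTop (𝓝 0) := by
      rw [← NNReal.tendsto_coe]
      simpa using tendsto_one_div_add_atTop_nhds_zero_nat (𝕜 := ℝ)
    have h1 : Tendsto (fun n : ℕ => u + (1 : ℝ≥0) / ((n : ℝ≥0) + 1)) atTop (𝓝 u) := by
      simpa using tendsto_const_nhds.add h0
    refine tendsto_of_tendsto_of_tendsto_of_le_of_le tendsto_const_nhds h1 (fun n => ?_) fun n => ?_
    · have hn : (0 : ℝ≥0) < (n : ℝ≥0) + 1 := by positivity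
      change u ≤ _
      rw [le_div_iff₀ hn]
      exact (Nat.lt_floor_add_one _).le
    · have hn : (0 : ℝ≥0) < (n : ℝ≥0) + 1 := by positivity
      change _ ≤ u + _
      rw [div_le_iff₀ hn, add_mul, div_mul_cancel₀ _ hn.ne']
      gcongr
      exact Nat.floor_le (zero_le)
  · have hn : (0 : ℝ≥0) < (n : ℝ≥0) + 1 := by positivity
    change u ≤ _
    rw [le_div_iff₀ hn]
    exact (Nat.lt_floor_add_one _).le

/-- Rounding time up to a grid leaves countably many times, for which joint measurability is clear;
right continuity makes the rounded processes converge pointwise. -/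
theorem measurable_uncurry_of_rightContinuous [PolishSpace S] [MeasurableSpace S] [BorelSpace S]
    [MeasurableSpace Ω] {Z : ℝ≥0 → Ω → S} (hZ : ∀ t, Measurable (Z t))
    (hr : ∀ ω, IsRightContinuousPath fun u => Z u ω) :
    Measurable fun q : ℝ≥0 × Ω => Z q.1 q.2 := by
  refine measurable_of_tendsto_metrizable
    (f := fun (n : ℕ) (q : ℝ≥0 × Ω) => Z (((⌊q.1 * (n + 1 : ℝ≥0)⌋₊ : ℝ≥0) + 1) / (n + 1)) q.2)
    (fun n => ?_) ?_
  · have h1 : Measurable fun q : ℕ × Ω => Z (((q.1 : ℝ≥0) + 1) / (n + 1)) q.2 :=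
      measurable_from_prod_countable_right fun k => hZ (((k : ℝ≥0) + 1) / (n + 1))
    have h2 : Measurable fun q : ℝ≥0 × Ω => ⌊q.1 * (n + 1 : ℝ≥0)⌋₊ :=
      Nat.measurable_floor.comp (by fun_prop)
    have h3 := h1.comp (h2.prodMk measurable_snd)
    simpa only [Function.comp_def] using h3
  · refine tendsto_pi_nhds.2 fun q => ?_
    exact (hr q.2 q.1).tendsto.comp (tendsto_floor_mul_add_one_div q.1)

theorem IsRightContinuousPath.measurable [PolishSpace S] [MeasurableSpace S] [BorelSpace S]
    {p : ℝ≥0 → S} (hp : IsRightContinuousPath p) : Measurable p :=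
  (measurable_uncurry_of_rightContinuous (Ω := Unit) (Z := fun u _ => p u)
    (fun _ => measurable_const) fun _ => hp).comp (measurable_id.prodMk (measurable_const (a := ())))

theorem IsRightContinuousPath.shift {p : ℝ≥0 → S} (hp : IsRightContinuousPath p) (s : ℝ≥0) :
    IsRightContinuousPath fun u => p (s + u) := fun t => by
  refine (hp (s + t)).comp (f := fun u => s + u) (by fun_prop) fun u hu => ?_
  simpa using hu

theorem IsRightContinuousPath.comp {p : ℝ≥0 → S} (hp : IsRightContinuousPath p) {c : ℝ≥0 → ℝ≥0}
    (hc : Continuous c) (hm : Monotone c) : IsRightContinuousPath fun u => p (c u) := fun t =>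
  (hp (c t)).comp (f := c) hc.continuousWithinAt fun _ hu => hm hu

theorem IsRightContinuousPath.continuousWithinAt_real {p : ℝ≥0 → S} (hp : IsRightContinuousPath p)
    {h : S → ℝ} (hh : Continuous h) (t : ℝ) :
    ContinuousWithinAt (fun u : ℝ => h (p u.toNNReal)) (Ici t) t := by
  refine hh.continuousAt.comp_continuousWithinAt ?_
  exact (hp t.toNNReal).comp (f := Real.toNNReal) continuous_real_toNNReal.continuousWithinAt
    fun _ hu => Real.toNNReal_mono hu

variable [PolishSpace S] [MeasurableSpace S] [BorelSpace S]

theorem IsRightContinuousPath.measurable_real {p : ℝ≥0 → S} (hp : IsRightContinuousPath p)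
    {h : S → ℝ} (hh : Continuous h) : Measurable fun u : ℝ => h (p u.toNNReal) :=
  hh.measurable.comp (hp.measurable.comp measurable_real_toNNReal)

theorem IsRightContinuousPath.intervalIntegrable {p : ℝ≥0 → S} (hp : IsRightContinuousPath p)
    (h : S →ᵇ ℝ) (a b : ℝ) : IntervalIntegrable (fun u : ℝ => h (p u.toNNReal)) volume a b := by
  rw [intervalIntegrable_iff]
  refine Measure.integrableOn_of_bounded (M := ‖h‖) (by simp)
    (hp.measurable_real h.continuous).aestronglyMeasurable ?_
  exact Eventually.of_forall fun u => h.norm_coe_le_norm _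

theorem IsRightContinuousPath.hasDerivWithinAt_integral {p : ℝ≥0 → S}
    (hp : IsRightContinuousPath p) (h : S →ᵇ ℝ) (a t : ℝ) :
    HasDerivWithinAt (fun s => ∫ u in a..s, h (p u.toNNReal)) (h (p t.toNNReal)) (Ici t) t :=
  intervalIntegral.integral_hasDerivWithinAt_right (s := Ici t) (t := Ioi t)
    (hp.intervalIntegrable h a t)
    (hp.measurable_real h.continuous).stronglyMeasurable.stronglyMeasurableAtFilter
    ((hp.continuousWithinAt_real h.continuous t).mono Ioi_subset_Ici_self)

end RightContinuousPaths

/-! ### Exponentials of bounded continuous functions. -/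

section ExpOfBounded

variable {S : Type*} [TopologicalSpace S]

theorem exp_comp_bound (f : S →ᵇ ℝ) (x : S) : ‖Real.exp (f x)‖ ≤ Real.exp ‖f‖ := by
  rw [Real.norm_eq_abs, Real.abs_exp]
  exact Real.exp_le_exp.2 ((le_abs_self _).trans (f.norm_coe_le_norm x))

/-- The exponential `exp ∘ f` of a bounded continuous function. -/
def expComp (f : S →ᵇ ℝ) : S →ᵇ ℝ :=
  BoundedContinuousFunction.ofNormedAddCommGroup (fun x => Real.exp (f x))
    (Real.continuous_exp.comp f.continuous) (Real.exp ‖f‖) (exp_comp_bound f)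

@[simp] theorem expComp_apply (f : S →ᵇ ℝ) (x : S) : expComp f x = Real.exp (f x) := rfl

theorem exp_neg_norm_le (f : S →ᵇ ℝ) (x : S) : Real.exp (-‖f‖) ≤ Real.exp (f x) :=
  Real.exp_le_exp.2 (neg_le_of_abs_le (f.norm_coe_le_norm x))

theorem exp_le_exp_norm (f : S →ᵇ ℝ) (x : S) : Real.exp (f x) ≤ Real.exp ‖f‖ :=
  Real.exp_le_exp.2 ((le_abs_self _).trans (f.norm_coe_le_norm x))

theorem expComp_neg_mul_expComp (f : S →ᵇ ℝ) : expComp (-f) * expComp f = 1 := by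
  ext x
  simp [← Real.exp_add]

end ExpOfBounded

/-! ### The clock and its inverse along a single path. -/

section PathClock

variable {S : Type*} [TopologicalSpace S]

/-- The clock along a path. -/
def pathClock (f : S →ᵇ ℝ) (p : ℝ≥0 → S) (s : ℝ) : ℝ :=
  ∫ u in (0 : ℝ)..s, Real.exp (f (p u.toNNReal))

/-- The inverse clock along a path. -/
def pathInv (f : S →ᵇ ℝ) (p : ℝ≥0 → S) (t : ℝ≥0) : ℝ≥0 :=
  sInf {s : ℝ≥0 | (t : ℝ) ≤ pathClock f p s}

@[simp] theorem pathClock_zero (f : S →ᵇ ℝ) (p : ℝ≥0 → S) : pathClock f p 0 = 0 := by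
  simp [pathClock]

variable [PolishSpace S] [MeasurableSpace S] [BorelSpace S] {f : S →ᵇ ℝ} {p : ℝ≥0 → S}

theorem pathClock_sub (hp : IsRightContinuousPath p) (a b : ℝ) :
    pathClock f p b - pathClock f p a = ∫ u in a..b, Real.exp (f (p u.toNNReal)) :=
  intervalIntegral.integral_interval_sub_left (hp.intervalIntegrable (expComp f) 0 b)
    (hp.intervalIntegrable (expComp f) 0 a)

theorem le_pathClock_sub (hp : IsRightContinuousPath p) {a b : ℝ} (hab : a ≤ b) :
    Real.exp (-‖f‖) * (b - a) ≤ pathClock f p b - pathClock f p a := by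
  rw [pathClock_sub hp]
  have := intervalIntegral.integral_mono (μ := volume) hab
    (intervalIntegrable_const (c := Real.exp (-‖f‖)))
    (hp.intervalIntegrable (expComp f) a b) fun u => exp_neg_norm_le f _
  simpa [mul_comm] using this

theorem continuous_pathClock (hp : IsRightContinuousPath p) : Continuous (pathClock f p) :=
  intervalIntegral.continuous_primitive (fun a b => hp.intervalIntegrable (expComp f) a b) 0

theorem strictMono_pathClock (hp : IsRightContinuousPath p) : StrictMono (pathClock f p) := by
  intro a b hab
  have := le_pathClock_sub (f := f) hp hab.le
  have : 0 < Real.exp (-‖f‖) * (b - a) := mul_pos (Real.exp_pos _) (sub_pos.2 hab)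
  linarith

/-- Strict monotonicity turns the set under the infimum into [s, ∞). Later identities for the
inverse clock are checked by applying the clock. -/
theorem pathInv_eq_of_pathClock_eq (hp : IsRightContinuousPath p) {s t : ℝ≥0}
    (h : pathClock f p s = t) : pathInv f p t = s := by
  have : {s' : ℝ≥0 | (t : ℝ) ≤ pathClock f p s'} = Ici s := by
    ext s'
    rw [mem_ofPred_eq, ← h, (strictMono_pathClock hp).le_iff_le, mem_Ici, NNReal.coe_le_coe]
  rw [pathInv, this, csInf_Ici]

theorem pathClock_pathInv (hp : IsRightContinuousPath p) (t : ℝ≥0) :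
    pathClock f p (pathInv f p t) = t := by
  -- The clock runs at speed at least e^{-‖f‖}, so it has reached t by time e^{‖f‖} t; the
  -- intermediate value theorem does the rest.
  have hb : (t : ℝ) ≤ pathClock f p (Real.exp ‖f‖ * t) := by
    have := le_pathClock_sub (f := f) hp (a := 0) (b := Real.exp ‖f‖ * t) (by positivity)
    rwa [sub_zero, pathClock_zero, sub_zero, ← mul_assoc, ← Real.exp_add, neg_add_cancel,
      Real.exp_zero, one_mul] at this
  obtain ⟨s, hs, hst⟩ := intermediate_value_Icc (by positivity : (0 : ℝ) ≤ Real.exp ‖f‖ * t)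
    (continuous_pathClock (f := f) hp).continuousOn (show (t : ℝ) ∈ _ by simp [hb])
  lift s to ℝ≥0 using hs.1
  rw [pathInv_eq_of_pathClock_eq hp hst, hst]

theorem pathInv_le_iff (hp : IsRightContinuousPath p) {s t : ℝ≥0} :
    pathInv f p t ≤ s ↔ (t : ℝ) ≤ pathClock f p s := by
  rw [← NNReal.coe_le_coe, ← (strictMono_pathClock (f := f) hp).le_iff_le, pathClock_pathInv hp]

theorem monotone_pathInv (hp : IsRightContinuousPath p) : Monotone (pathInv f p) := by
  intro s t hst
  rw [pathInv_le_iff hp, pathClock_pathInv hp]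
  exact_mod_cast hst

theorem pathInv_sub_le (hp : IsRightContinuousPath p) {s t : ℝ≥0} (hst : s ≤ t) :
    (pathInv f p t : ℝ) - pathInv f p s ≤ Real.exp ‖f‖ * (t - s) := by
  have := le_pathClock_sub (f := f) hp (NNReal.coe_le_coe.2 (monotone_pathInv (f := f) hp hst))
  rw [pathClock_pathInv hp, pathClock_pathInv hp, Real.exp_neg,
    inv_mul_le_iff₀ (Real.exp_pos _)] at this
  exact this

theorem continuous_pathInv (hp : IsRightContinuousPath p) : Continuous (pathInv f p) := by
  refine (LipschitzWith.of_dist_le_mul (K := ⟨Real.exp ‖f‖, (Real.exp_pos _).le⟩)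
    fun s t => ?_).continuous
  wlog hst : s ≤ t generalizing s t
  · rw [dist_comm, dist_comm s t]
    exact this t s (le_of_not_ge hst)
  · rw [dist_comm, dist_comm s t, NNReal.dist_eq, NNReal.dist_eq,
      abs_of_nonneg (sub_nonneg.2 (NNReal.coe_le_coe.2 (monotone_pathInv hp hst))),
      abs_of_nonneg (sub_nonneg.2 (NNReal.coe_le_coe.2 hst))]
    exact pathInv_sub_le hp hst

@[simp] theorem pathInv_zero (hp : IsRightContinuousPath p) : pathInv f p 0 = 0 :=
  pathInv_eq_of_pathClock_eq hp (by simp)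

theorem pathInv_le (hp : IsRightContinuousPath p) (t : ℝ≥0) :
    (pathInv f p t : ℝ) ≤ Real.exp ‖f‖ * t := by
  simpa [pathInv_zero hp] using pathInv_sub_le (f := f) hp (zero_le : 0 ≤ t)

theorem pathInv_zero_fun (hp : IsRightContinuousPath p) (t : ℝ≥0) :
    pathInv (0 : S →ᵇ ℝ) p t = t :=
  pathInv_eq_of_pathClock_eq hp (by simp [pathClock])

theorem pathClock_add (hp : IsRightContinuousPath p) (s r : ℝ≥0) :
    pathClock f p (s + r) = pathClock f p s + pathClock f (fun u => p (s + u)) r := by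
  rw [← sub_eq_iff_eq_add', pathClock_sub hp, pathClock]
  have := intervalIntegral.integral_comp_add_left (a := 0) (b := r)
    (fun u : ℝ => Real.exp (f (p u.toNNReal))) s
  rw [add_zero] at this
  rw [← this]
  refine intervalIntegral.integral_congr fun u hu => ?_
  rw [uIcc_of_le (NNReal.coe_nonneg r)] at hu
  simp [Real.toNNReal_add (NNReal.coe_nonneg s) hu.1]

/-- The cocycle property behind the Markov property: after the clock has reached s, the remaining
wait is the inverse clock of the shifted path. -/
theorem pathInv_add (hp : IsRightContinuousPath p) (s t : ℝ≥0) :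
    pathInv f p (s + t) = pathInv f p s + pathInv f (fun u => p (pathInv f p s + u)) t := by
  apply pathInv_eq_of_pathClock_eq hp
  rw [NNReal.coe_add, pathClock_add hp, pathClock_pathInv hp, pathClock_pathInv (hp.shift _)]
  simp

theorem isRightContinuousPath_comp_pathInv (hp : IsRightContinuousPath p) :
    IsRightContinuousPath fun t => p (pathInv f p t) :=
  hp.comp (continuous_pathInv hp) (monotone_pathInv hp)

/-- Change of variables in an integral along a time-changed path. -/
theorem integral_comp_pathInv (hp : IsRightContinuousPath p) (w : S →ᵇ ℝ) (t : ℝ≥0) :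
    ∫ u in (0 : ℝ)..t, w (p (pathInv f p u.toNNReal))
      = ∫ u in (0 : ℝ)..pathInv f p t, (w * expComp f) (p u.toNNReal) := by
  have hq := isRightContinuousPath_comp_pathInv (f := f) hp
  -- As functions of the original time s, both integrals have right derivative w · e^f along the
  -- path. Paths are only right-continuous, so a constancy criterion with one-sided derivatives is
  -- needed.
  have key : ∀ s ∈ Icc (0 : ℝ) (pathInv f p t),
      (∫ u in (0 : ℝ)..pathClock f p s, w (p (pathInv f p u.toNNReal)))
        - ∫ u in (0 : ℝ)..s, (w * expComp f) (p u.toNNReal) = 0 := by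
    intro s hs
    rw [constant_of_has_deriv_right_zero (f := fun s =>
      (∫ u in (0 : ℝ)..pathClock f p s, w (p (pathInv f p u.toNNReal)))
        - ∫ u in (0 : ℝ)..s, (w * expComp f) (p u.toNNReal)) ?_ (fun r hr => ?_) s hs]
    · simp
    · refine (Continuous.sub ?_ ?_).continuousOn
      · exact (intervalIntegral.continuous_primitive (fun a b => hq.intervalIntegrable w a b)
          0).comp (continuous_pathClock hp)
      · exact intervalIntegral.continuous_primitive
          (fun a b => hp.intervalIntegrable (w * expComp f) a b) 0
    · have h1 := hp.hasDerivWithinAt_integral (expComp f) 0 r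
      have h2 := (hq.hasDerivWithinAt_integral w 0 (pathClock f p r)).comp r h1
        fun a ha => (strictMono_pathClock (f := f) hp).monotone ha
      have h3 := h2.sub (hp.hasDerivWithinAt_integral (w * expComp f) 0 r)
      have hinv : pathInv f p (pathClock f p r).toNNReal = r.toNNReal := by
        apply pathInv_eq_of_pathClock_eq hp
        have h0 : 0 ≤ pathClock f p r := by
          simpa using (strictMono_pathClock (f := f) hp).monotone hr.1
        rw [Real.coe_toNNReal _ hr.1, Real.coe_toNNReal _ h0]
      rw [hinv, BoundedContinuousFunction.mul_apply, sub_self] at h3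
      exact h3
  have := key (pathInv f p t) ⟨NNReal.coe_nonneg _, le_rfl⟩
  rw [pathClock_pathInv hp] at this
  linarith

end PathClock

/-! ### Measurability of clocks, stopping times and their prior events. -/

section ProcessMeasurability

set_option linter.unusedSectionVars false

variable {S Ω : Type*} [TopologicalSpace S] [PolishSpace S] [MeasurableSpace S] [BorelSpace S]

theorem measurable_pathClock [MeasurableSpace Ω] {Z : ℝ≥0 → Ω → S} (hZ : ∀ t, Measurable (Z t))
    (hr : ∀ ω, IsRightContinuousPath fun u => Z u ω) (f : S →ᵇ ℝ) (s : ℝ≥0) :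
    Measurable fun ω => pathClock f (fun u => Z u ω) s := by
  simp only [pathClock, intervalIntegral.integral_of_le (NNReal.coe_nonneg s)]
  refine (StronglyMeasurable.integral_prod_right (f := fun ω (u : ℝ) =>
    Real.exp (f (Z u.toNNReal ω))) ?_).measurable
  refine Measurable.stronglyMeasurable ?_
  exact Real.measurable_exp.comp (f.continuous.measurable.comp
    ((measurable_uncurry_of_rightContinuous hZ hr).comp
      ((measurable_real_toNNReal.comp measurable_snd).prodMk measurable_fst)))

theorem measurable_pathInv [MeasurableSpace Ω] {Z : ℝ≥0 → Ω → S} (hZ : ∀ t, Measurable (Z t))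
    (hr : ∀ ω, IsRightContinuousPath fun u => Z u ω) (f : S →ᵇ ℝ) (t : ℝ≥0) :
    Measurable fun ω => pathInv f (fun u => Z u ω) t := by
  refine measurable_of_Iic fun s => ?_
  have : (fun ω => pathInv f (fun u => Z u ω) t) ⁻¹' Iic s
      = {ω | (t : ℝ) ≤ pathClock f (fun u => Z u ω) s} := by
    ext ω
    exact pathInv_le_iff (hr ω)
  rw [this]
  exact measurableSet_le measurable_const (measurable_pathClock hZ hr f s)

theorem measurable_comp_pathInv [MeasurableSpace Ω] {Z : ℝ≥0 → Ω → S}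
    (hZ : ∀ t, Measurable (Z t)) (hr : ∀ ω, IsRightContinuousPath fun u => Z u ω) (f : S →ᵇ ℝ)
    (t : ℝ≥0) : Measurable fun ω => Z (pathInv f (fun u => Z u ω) t) ω :=
  (measurable_uncurry_of_rightContinuous hZ hr).comp
    ((measurable_pathInv hZ hr f t).prodMk measurable_id)

theorem measurable_rightPath_eval (t : ℝ≥0) : Measurable fun p : RightPath S => p.1 t :=
  (measurable_pi_apply t).comp measurable_subtype_coe

theorem integral_intervalIntegral_comp [MeasurableSpace Ω] {Z : ℝ≥0 → Ω → S}
    (hZ : ∀ t, Measurable (Z t)) (hr : ∀ ω, IsRightContinuousPath fun u => Z u ω) (w : S →ᵇ ℝ)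
    (μ : Measure Ω) [IsFiniteMeasure μ] (t : ℝ≥0) :
    ∫ ω, (∫ u in (0 : ℝ)..t, w (Z u.toNNReal ω)) ∂μ
      = ∫ u in (0 : ℝ)..t, ∫ ω, w (Z u.toNNReal ω) ∂μ := by
  simp only [intervalIntegral.integral_of_le (NNReal.coe_nonneg t)]
  refine integral_integral_swap (f := fun ω (u : ℝ) => w (Z u.toNNReal ω)) ?_
  refine Integrable.of_bound (C := ‖w‖) ?_ (Eventually.of_forall fun _ => w.norm_coe_le_norm _)
  refine Measurable.aestronglyMeasurable ?_
  exact w.continuous.measurable.comp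
    ((measurable_uncurry_of_rightContinuous hZ hr).comp
      ((measurable_real_toNNReal.comp measurable_snd).prodMk measurable_fst))

/-- The running integral is continuous in its upper limit, so it is itself a right-continuous
process and the joint measurability lemma applies to it. -/
theorem measurable_intervalIntegral_comp [MeasurableSpace Ω] {Z : ℝ≥0 → Ω → S}
    (hZ : ∀ t, Measurable (Z t)) (hr : ∀ ω, IsRightContinuousPath fun u => Z u ω) (w : S →ᵇ ℝ) :
    Measurable fun q : ℝ≥0 × Ω => ∫ r in (0 : ℝ)..q.1, w (Z r.toNNReal q.2) := by
  refine measurable_uncurry_of_rightContinuous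
    (Z := fun (t : ℝ≥0) ω => ∫ r in (0 : ℝ)..t, w (Z r.toNNReal ω)) (fun t => ?_) fun ω t => ?_
  · simp only [intervalIntegral.integral_of_le (NNReal.coe_nonneg t)]
    refine (StronglyMeasurable.integral_prod_right (f := fun ω (u : ℝ) =>
      w (Z u.toNNReal ω)) ?_).measurable
    refine Measurable.stronglyMeasurable ?_
    exact w.continuous.measurable.comp
      ((measurable_uncurry_of_rightContinuous hZ hr).comp
        ((measurable_real_toNNReal.comp measurable_snd).prodMk measurable_fst))
  · exact ((intervalIntegral.continuous_primitive
      (fun a b => (hr ω).intervalIntegrable w a b) 0).comp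
        NNReal.continuous_coe).continuousWithinAt

theorem abs_intervalIntegral_comp_le (p : ℝ≥0 → S) (w : S →ᵇ ℝ) (t : ℝ≥0) :
    |∫ r in (0 : ℝ)..t, w (p r.toNNReal)| ≤ ‖w‖ * t := by
  have := intervalIntegral.norm_integral_le_of_norm_le_const (a := (0 : ℝ)) (b := t)
    (f := fun r => w (p r.toNNReal)) (C := ‖w‖) fun r _ => w.norm_coe_le_norm _
  simpa using this

variable {X : ℝ≥0 → Ω → S}

theorem measurable_history {s t : ℝ≥0} (hst : s ≤ t) : Measurable[history X t] (X s) := by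
  intro B hB
  have : MeasurableSpace.comap (X s) inferInstance ≤ history X t :=
    le_iSup₂_of_le (f := fun u (_ : u ∈ Iic t) => MeasurableSpace.comap (X u) inferInstance) s
      hst le_rfl
  exact this _ ⟨B, hB, rfl⟩

theorem history_mono {s t : ℝ≥0} (hst : s ≤ t) : history X s ≤ history X t :=
  iSup₂_le fun _ hu => (measurable_history (le_trans hu hst)).comap_le

theorem history_le [mΩ : MeasurableSpace Ω] (hX : ∀ t, Measurable (X t)) (t : ℝ≥0) :
    history X t ≤ mΩ :=
  iSup₂_le fun _ _ => (hX _).comap_le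

theorem isRightContinuousPath_min {p : ℝ≥0 → S} (hp : IsRightContinuousPath p) (t : ℝ≥0) :
    IsRightContinuousPath fun u => p (min u t) :=
  hp.comp (by fun_prop) fun _ _ h => min_le_min_right t h

/-- Progressive measurability: the path frozen at time t involves only X u with u ≤ t and is still
right-continuous. -/
theorem measurable_history_uncurry_min (hr : ∀ ω, IsRightContinuousPath fun u => X u ω)
    (t : ℝ≥0) :
    Measurable[@Prod.instMeasurableSpace ℝ≥0 Ω _ (history X t)]
      fun q : ℝ≥0 × Ω => X (min q.1 t) q.2 :=
  @measurable_uncurry_of_rightContinuous S Ω _ _ _ _ (history X t) (fun u => X (min u t))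
    (fun _ => measurable_history (min_le_right _ _)) fun ω => isRightContinuousPath_min (hr ω) t

theorem measurable_history_pathClock (hr : ∀ ω, IsRightContinuousPath fun u => X u ω)
    (f : S →ᵇ ℝ) (t : ℝ≥0) :
    Measurable[history X t] fun ω => pathClock f (fun u => X u ω) t := by
  have := @measurable_pathClock S Ω _ _ _ _ (history X t) (fun u => X (min u t))
    (fun _ => measurable_history (min_le_right _ _))
    (fun ω => isRightContinuousPath_min (hr ω) t) f t
  convert this using 2 with ω
  refine intervalIntegral.integral_congr fun u hu => ?_
  rw [uIcc_of_le (NNReal.coe_nonneg t)] at hu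
  have : u.toNNReal ≤ t := by simpa using Real.toNNReal_le_toNNReal hu.2
  simp [min_eq_left this]

/-- The inverse clock at t is at most s exactly when the clock at s is at least t, which depends on
the path up to s only. -/
theorem isFiniteStoppingTime_pathInv (hr : ∀ ω, IsRightContinuousPath fun u => X u ω)
    (f : S →ᵇ ℝ) (t : ℝ≥0) :
    IsFiniteStoppingTime X fun ω => pathInv f (fun u => X u ω) t := by
  intro s
  have : {ω | pathInv f (fun u => X u ω) t ≤ s}
      = {ω | (t : ℝ) ≤ pathClock f (fun u => X u ω) s} := by
    ext ω
    exact pathInv_le_iff (hr ω)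
  rw [this]
  let _ : MeasurableSpace Ω := history X s
  exact measurableSet_le measurable_const (measurable_history_pathClock hr f s)

/-- The `σ`-algebra of events prior to a finite stopping time. -/
@[reducible] def priorSigma (X : ℝ≥0 → Ω → S) (τ : Ω → ℝ≥0) (hτ : IsFiniteStoppingTime X τ) :
    MeasurableSpace Ω where
  MeasurableSet' A := IsPriorEvent X τ A
  measurableSet_empty t := by simp
  measurableSet_compl A hA t := by
    have : Aᶜ ∩ {ω | τ ω ≤ t} = {ω | τ ω ≤ t} \ (A ∩ {ω | τ ω ≤ t}) := by
      ext ω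
      simp only [mem_inter_iff, mem_compl_iff, Set.mem_sdiff]
      tauto
    rw [this]
    exact MeasurableSet.diff (hτ t) (hA t)
  measurableSet_iUnion A hA t := by
    rw [iUnion_inter]
    exact MeasurableSet.iUnion fun i => hA i t

theorem measurable_priorSigma_self {τ : Ω → ℝ≥0} (hτ : IsFiniteStoppingTime X τ) :
    Measurable[priorSigma X τ hτ] τ := by
  let _ : MeasurableSpace Ω := priorSigma X τ hτ
  refine measurable_of_Iic fun s t => ?_
  have : τ ⁻¹' Iic s ∩ {ω | τ ω ≤ t} = {ω | τ ω ≤ min s t} := by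
    ext ω
    simp
  rw [this]
  exact history_mono (min_le_right s t) _ (hτ _)

/-- On {τ ≤ t} one may replace σ by min σ t, which is known at time t; progressive measurability
then handles X at that time. -/
theorem measurable_priorSigma_of_le (hr : ∀ ω, IsRightContinuousPath fun u => X u ω)
    {σ τ : Ω → ℝ≥0} (hσ : IsFiniteStoppingTime X σ) (hτ : IsFiniteStoppingTime X τ)
    (hle : ∀ ω, σ ω ≤ τ ω) : Measurable[priorSigma X τ hτ] fun ω => X (σ ω) ω := by
  intro B hB t
  let _ : MeasurableSpace Ω := history X t
  have h1 : Measurable[history X t] fun ω => min (σ ω) t := by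
    refine measurable_of_Iic fun s => ?_
    rcases le_total t s with h | h
    · have : (fun ω => min (σ ω) t) ⁻¹' Iic s = univ := by
        ext ω
        simp [h]
      rw [this]
      exact MeasurableSet.univ
    · rcases h.lt_or_eq with h' | rfl
      · have : (fun ω => min (σ ω) t) ⁻¹' Iic s = {ω | σ ω ≤ s} := by
          ext ω
          simp [h'.not_ge]
        rw [this]
        exact history_mono h _ (hσ s)
      · have : (fun ω => min (σ ω) s) ⁻¹' Iic s = univ := by
          ext ω
          simp
        rw [this]
        exact MeasurableSet.univ
  have h2 : Measurable[history X t] fun ω => X (min (σ ω) t) ω := by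
    have := (measurable_history_uncurry_min hr t).comp (h1.prodMk measurable_id)
    simpa [Function.comp_def] using this
  have : (fun ω => X (σ ω) ω) ⁻¹' B ∩ {ω | τ ω ≤ t}
      = (fun ω => X (min (σ ω) t) ω) ⁻¹' B ∩ {ω | τ ω ≤ t} := by
    ext ω
    simp only [mem_inter_iff, mem_preimage, mem_ofPred_eq, and_congr_left_iff]
    intro h
    rw [min_eq_left ((hle ω).trans h)]
  rw [this]
  exact MeasurableSet.inter (h2 hB) (hτ t)

end ProcessMeasurability

/-! ### Time-changed processes: Markov property and Dynkin's formula. -/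

namespace StrongMarkovProcess

section TimeChange

set_option linter.unusedSectionVars false

variable {S Ω : Type*} [TopologicalSpace S] [MeasurableSpace S] [MeasurableSpace Ω]
  (M : StrongMarkovProcess S Ω)

instance : IsMarkovKernel M.P := M.isMarkovKernel

theorem isRightContinuousPath_X (ω : Ω) : IsRightContinuousPath fun u => M.X u ω :=
  M.rightContinuous ω

/-- The path of the process after the time `τ`. -/
def pathAfter (τ : Ω → ℝ≥0) (ω : Ω) : RightPath S :=
  ⟨fun t => M.X (τ ω + t) ω, (M.isRightContinuousPath_X ω).shift (τ ω)⟩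

/-- The path of the process. -/
def path (ω : Ω) : RightPath S := ⟨fun t => M.X t ω, M.isRightContinuousPath_X ω⟩

theorem measurable_path : Measurable M.path :=
  Measurable.subtype_mk (measurable_pi_lambda _ M.measurable_X)

theorem timeChanged_apply (f : S →ᵇ ℝ) (t : ℝ≥0) (ω : Ω) :
    M.timeChanged f t ω = M.X (pathInv f (fun u => M.X u ω) t) ω := rfl

variable [PolishSpace S] [BorelSpace S]

theorem measurable_X_uncurry : Measurable fun q : ℝ≥0 × Ω => M.X q.1 q.2 :=
  measurable_uncurry_of_rightContinuous M.measurable_X M.isRightContinuousPath_X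

theorem measurable_X_comp {τ : Ω → ℝ≥0} (hτ : Measurable τ) :
    Measurable fun ω => M.X (τ ω) ω :=
  M.measurable_X_uncurry.comp (hτ.prodMk measurable_id)

theorem measurable_pathAfter {τ : Ω → ℝ≥0} (hτ : Measurable τ) : Measurable (M.pathAfter τ) :=
  Measurable.subtype_mk <| measurable_pi_lambda _ fun t =>
    M.measurable_X_comp (τ := fun ω => τ ω + t) (hτ.add_const t)

theorem measurable_of_isFiniteStoppingTime {τ : Ω → ℝ≥0} (hτ : IsFiniteStoppingTime M.X τ) :
    Measurable τ :=
  measurable_of_Iic fun s => history_le M.measurable_X s _ (hτ s)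

/-- The inverse clock is shown measurable on right-continuous paths, not on the full product space.
Measurable sets of such paths are traces of product-measurable sets, so the strong Markov property
carries over. -/
theorem strongMarkov_rightPath (x : S) {τ : Ω → ℝ≥0} (hτ : IsFiniteStoppingTime M.X τ)
    {A : Set Ω} (hA : IsPriorEvent M.X τ A) {B : Set (RightPath S)} (hB : MeasurableSet B) :
    M.P x (A ∩ M.pathAfter τ ⁻¹' B)
      = ∫⁻ ω in A, M.P (M.X (τ ω) ω) (M.path ⁻¹' B) ∂(M.P x) := by
  obtain ⟨B', hB', rfl⟩ := hB
  exact M.strongMarkov x τ hτ A hA B' hB'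

theorem isStoppingTime_inverseClock (f : S →ᵇ ℝ) (t : ℝ≥0) :
    IsFiniteStoppingTime M.X (M.inverseClock f t) :=
  isFiniteStoppingTime_pathInv M.isRightContinuousPath_X f t

theorem isRightContinuousPath_timeChanged (f : S →ᵇ ℝ) (ω : Ω) :
    IsRightContinuousPath fun t => M.timeChanged f t ω :=
  isRightContinuousPath_comp_pathInv (M.isRightContinuousPath_X ω)

theorem measurable_timeChanged (f : S →ᵇ ℝ) (t : ℝ≥0) : Measurable (M.timeChanged f t) :=
  measurable_comp_pathInv M.measurable_X M.isRightContinuousPath_X f t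

theorem timeChanged_zero : M.timeChanged 0 = M.X := by
  funext t ω
  rw [timeChanged_apply, pathInv_zero_fun (M.isRightContinuousPath_X ω)]

theorem timeChanged_start (f : S →ᵇ ℝ) (x : S) : ∀ᵐ ω ∂(M.P x), M.timeChanged f 0 ω = x := by
  filter_upwards [M.start x] with ω hω
  rw [timeChanged_apply, pathInv_zero (M.isRightContinuousPath_X ω), hω]

theorem timeChanged_add (f : S →ᵇ ℝ) (s t : ℝ≥0) (ω : Ω) :
    M.timeChanged f (s + t) ω = (M.pathAfter (M.inverseClock f s) ω).1
      (pathInv f (M.pathAfter (M.inverseClock f s) ω).1 t) := by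
  rw [timeChanged_apply, pathInv_add (M.isRightContinuousPath_X ω)]
  rfl

theorem measurable_rightPath_comp_pathInv (f : S →ᵇ ℝ) (t : ℝ≥0) :
    Measurable fun p : RightPath S => p.1 (pathInv f p.1 t) :=
  measurable_comp_pathInv (Z := fun u (p : RightPath S) => p.1 u) measurable_rightPath_eval
    (fun p => p.2) f t

/-- The inverse clock is monotone, so the time-changed process up to s only looks at X up to the
inverse clock at s. -/
theorem isPriorEvent_of_measurableSet_history (f : S →ᵇ ℝ) (s : ℝ≥0) {A : Set Ω}
    (hA : MeasurableSet[history (M.timeChanged f) s] A) :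
    IsPriorEvent M.X (M.inverseClock f s) A := by
  have hle : history (M.timeChanged f) s
      ≤ priorSigma M.X (M.inverseClock f s) (M.isStoppingTime_inverseClock f s) :=
    iSup₂_le fun u hu => Measurable.comap_le <|
      measurable_priorSigma_of_le M.isRightContinuousPath_X (M.isStoppingTime_inverseClock f u) _
        fun ω => monotone_pathInv (M.isRightContinuousPath_X ω) hu
  exact hle A hA

theorem timeChanged_markov (f : S →ᵇ ℝ) (x : S) (s t : ℝ≥0) (A : Set Ω)
    (hA : MeasurableSet[history (M.timeChanged f) s] A) (B : Set S) (hB : MeasurableSet B) :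
    M.P x (A ∩ {ω | M.timeChanged f (s + t) ω ∈ B})
      = ∫⁻ ω in A, M.P (M.timeChanged f s ω) {ω' | M.timeChanged f t ω' ∈ B} ∂(M.P x) := by
  have := M.strongMarkov_rightPath x (M.isStoppingTime_inverseClock f s)
    (M.isPriorEvent_of_measurableSet_history f s hA) (measurable_rightPath_comp_pathInv f t hB)
  simp only [timeChanged_add]
  exact this

/-- The strong Markov property for functionals of a stopping time and of the path after it. -/
theorem integral_pathAfter (x : S) {τ : Ω → ℝ≥0} (hτ : IsFiniteStoppingTime M.X τ)
    {F : ℝ≥0 × RightPath S → ℝ} (hF : Measurable F) {C : ℝ} (hC : ∀ q, |F q| ≤ C) :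
    ∫ ω, F (τ ω, M.pathAfter τ ω) ∂(M.P x)
      = ∫ ω, ∫ ω', F (τ ω, M.path ω') ∂(M.P (M.X (τ ω) ω)) ∂(M.P x) := by
  have hτm := M.measurable_of_isFiniteStoppingTime hτ
  let κ : Kernel Ω (RightPath S) := (M.P.map M.path).comap (fun ω => M.X (τ ω) ω)
    (M.measurable_X_comp hτm)
  have hmap : IsMarkovKernel (M.P.map M.path) := Kernel.IsMarkovKernel.map _ M.measurable_path
  have hκ : IsMarkovKernel κ := Kernel.IsMarkovKernel.comap _ _
  have hκa : ∀ ω, κ ω = (M.P (M.X (τ ω) ω)).map M.path := fun ω => by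
    rw [Kernel.comap_apply, Kernel.map_apply _ M.measurable_path]
  have h1 : Measurable fun ω => (τ ω, M.pathAfter τ ω) := hτm.prodMk (M.measurable_pathAfter hτm)
  have h2 : Measurable fun q : Ω × RightPath S => (τ q.1, q.2) :=
    (hτm.comp measurable_fst).prodMk measurable_snd
  have hlaw : (M.P x).map (fun ω => (τ ω, M.pathAfter τ ω))
      = ((M.P x) ⊗ₘ κ).map fun q => (τ q.1, q.2) := by
    have : IsProbabilityMeasure ((M.P x).map (fun ω => (τ ω, M.pathAfter τ ω))) :=
      Measure.isProbabilityMeasure_map h1.aemeasurable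
    -- Rectangles determine the law. On s × t the claim is the strong Markov property with the prior
    -- event {τ ∈ s}.
    refine Measure.ext_prod fun {s t} hs ht => ?_
    rw [Measure.map_apply h1 (hs.prod ht), Measure.map_apply h2 (hs.prod ht)]
    have e1 : (fun ω => (τ ω, M.pathAfter τ ω)) ⁻¹' s ×ˢ t
        = τ ⁻¹' s ∩ M.pathAfter τ ⁻¹' t := rfl
    have e2 : (fun q : Ω × RightPath S => (τ q.1, q.2)) ⁻¹' s ×ˢ t = (τ ⁻¹' s) ×ˢ t := rfl
    rw [e1, e2, Measure.compProd_apply_prod (hτm hs) ht,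
      M.strongMarkov_rightPath x hτ (measurable_priorSigma_self hτ hs) ht]
    refine lintegral_congr fun ω => ?_
    rw [hκa, Measure.map_apply M.measurable_path ht]
  have hi : Integrable (fun q : Ω × RightPath S => F (τ q.1, q.2)) ((M.P x) ⊗ₘ κ) :=
    Integrable.of_bound (hF.comp h2).aestronglyMeasurable C (Eventually.of_forall fun q => hC _)
  rw [← integral_map (f := F) h1.aemeasurable hF.aestronglyMeasurable, hlaw,
    integral_map h2.aemeasurable hF.aestronglyMeasurable, Measure.integral_compProd hi]
  refine integral_congr_ae (Eventually.of_forall fun ω => ?_)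
  dsimp only
  rw [hκa, integral_map (f := fun p => F (τ ω, p)) M.measurable_path.aemeasurable
    (hF.comp measurable_prodMk_left).aestronglyMeasurable]

/-- The semi-group property of a time-changed process, for bounded measurable functions. -/
theorem expect_timeChanged_add (f : S →ᵇ ℝ) (s t : ℝ≥0) {h : S → ℝ} (hh : Measurable h) {C : ℝ}
    (hC : ∀ x, |h x| ≤ C) (x : S) :
    M.expect (M.timeChanged f) (s + t) h x
      = M.expect (M.timeChanged f) s (M.expect (M.timeChanged f) t h) x := by
  have := M.integral_pathAfter x (M.isStoppingTime_inverseClock f s)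
    (F := fun q => h (q.2.1 (pathInv f q.2.1 t)))
    (hh.comp ((measurable_rightPath_comp_pathInv f t).comp measurable_snd)) (fun q => hC _)
  simp only [expect, timeChanged_add]
  exact this

theorem abs_expect_le_of_abs_le (Y : ℝ≥0 → Ω → S) (t : ℝ≥0) {h : S → ℝ} {C : ℝ}
    (hC : ∀ x, |h x| ≤ C) (x : S) : |M.expect Y t h x| ≤ C := by
  have := norm_integral_le_of_norm_le_const (μ := M.P x) (f := fun ω => h (Y t ω)) (C := C)
    (Eventually.of_forall fun ω => hC _)
  simpa [expect] using this

theorem measurable_expect {Y : ℝ≥0 → Ω → S} {t : ℝ≥0} (hY : Measurable (Y t)) {h : S → ℝ}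
    (hh : Measurable h) : Measurable (M.expect Y t h) :=
  (StronglyMeasurable.integral_kernel (κ := M.P) (hh.comp hY).stronglyMeasurable).measurable

theorem integrable_comp_of_abs_le {Y : ℝ≥0 → Ω → S} {t : ℝ≥0} (hY : Measurable (Y t))
    {h : S → ℝ} (hh : Measurable h) {C : ℝ} (hC : ∀ x, |h x| ≤ C) (x : S) :
    Integrable (fun ω => h (Y t ω)) (M.P x) :=
  Integrable.of_bound (hh.comp hY).aestronglyMeasurable C (Eventually.of_forall fun _ => hC _)

theorem expect_sub {Y : ℝ≥0 → Ω → S} {t : ℝ≥0} (hY : Measurable (Y t)) {h k : S → ℝ}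
    (hh : Measurable h) (hk : Measurable k) {C C' : ℝ} (hC : ∀ x, |h x| ≤ C)
    (hC' : ∀ x, |k x| ≤ C') (x : S) :
    M.expect Y t (fun y => h y - k y) x = M.expect Y t h x - M.expect Y t k x :=
  integral_sub (M.integrable_comp_of_abs_le hY hh hC x) (M.integrable_comp_of_abs_le hY hk hC' x)

/-- **Dynkin's formula** for a time-changed process. -/
theorem expect_timeChanged_sub (f u v : S →ᵇ ℝ)
    (huv : ∀ (t : ℝ≥0) (y : S),
      M.semigroup t u y - u y = ∫ r in (0 : ℝ)..t, M.semigroup r.toNNReal v y)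
    (t : ℝ≥0) (x : S) :
    M.expect (M.timeChanged f) t u x - u x
      = ∫ r in (0 : ℝ)..t,
          M.expect (M.timeChanged f) r.toNNReal (v * expComp (-f) : S →ᵇ ℝ) x := by
  -- The expectation of the Dynkin martingale at a deterministic time.
  have hmart : ∀ (a : ℝ≥0) (y : S),
      ∫ ω, (u (M.X a ω) - ∫ r in (0 : ℝ)..a, v (M.X r.toNNReal ω)) ∂(M.P y) = u y := by
    intro a y
    rw [integral_sub (M.integrable_comp a u y), integral_intervalIntegral_comp M.measurable_X
      M.isRightContinuousPath_X]
    · have := huv a y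
      change M.semigroup a u y - (∫ r in (0 : ℝ)..a, M.semigroup r.toNNReal v y) = u y
      linarith
    · refine Integrable.of_bound (C := ‖v‖ * a) ?_ (Eventually.of_forall fun ω =>
        abs_intervalIntegral_comp_le (fun r => M.X r ω) v a)
      exact ((measurable_intervalIntegral_comp M.measurable_X M.isRightContinuousPath_X v).comp
        measurable_prodMk_left).aestronglyMeasurable
  set τ : Ω → ℝ≥0 := M.inverseClock f t with hτdef
  have hτ : IsFiniteStoppingTime M.X τ := M.isStoppingTime_inverseClock f t
  have hτm : Measurable τ := M.measurable_of_isFiniteStoppingTime hτ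
  -- A deterministic bound for τ, since the clock has speed at least e^{-‖f‖}.
  set T : ℝ≥0 := ⟨Real.exp ‖f‖ * t, by positivity⟩ with hT
  have hτT : ∀ ω, τ ω ≤ T := fun ω => pathInv_le (M.isRightContinuousPath_X ω) t
  -- Optional stopping by hand: F is the martingale of the path after τ, run for the remaining time
  -- T - τ. Given the past of τ, its mean is u(X_τ) by `hmart`. Pathwise it equals the martingale of
  -- X at T plus the integral of v up to τ, and `hmart` at T gives Dynkin's formula.
  let F : ℝ≥0 × RightPath S → ℝ := fun q =>
    u (q.2.1 (T - q.1)) - ∫ r in (0 : ℝ)..((T - q.1 : ℝ≥0) : ℝ), v (q.2.1 r.toNNReal)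
  have hsub : Measurable fun q : ℝ≥0 × RightPath S => (T - q.1, q.2) :=
    (measurable_fst.const_sub T).prodMk measurable_snd
  have hF : Measurable F := by
    refine Measurable.sub ?_ ?_
    · exact u.continuous.measurable.comp ((measurable_uncurry_of_rightContinuous
        (Z := fun r (p : RightPath S) => p.1 r) measurable_rightPath_eval fun p => p.2).comp hsub)
    · exact (measurable_intervalIntegral_comp (Z := fun r (p : RightPath S) => p.1 r)
        measurable_rightPath_eval (fun p => p.2) v).comp hsub
  have hFb : ∀ q, |F q| ≤ ‖u‖ + ‖v‖ * T := fun q => by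
    refine (abs_sub _ _).trans (add_le_add (u.norm_coe_le_norm _) ?_)
    refine (abs_intervalIntegral_comp_le q.2.1 v _).trans ?_
    gcongr
    exact tsub_le_self
  have hfreeze := M.integral_pathAfter x hτ hF hFb
  have hleft : ∀ ω, F (τ ω, M.pathAfter τ ω)
      = (u (M.X T ω) - ∫ r in (0 : ℝ)..T, v (M.X r.toNNReal ω))
        + ∫ r in (0 : ℝ)..τ ω, v (M.X r.toNNReal ω) := by
    intro ω
    have hX := M.isRightContinuousPath_X ω
    have e1 : τ ω + (T - τ ω) = T := add_tsub_cancel_of_le (hτT ω)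
    have e2 : ∫ r in (0 : ℝ)..((T - τ ω : ℝ≥0) : ℝ), v (M.X (τ ω + r.toNNReal) ω)
        = ∫ r in (τ ω : ℝ)..T, v (M.X r.toNNReal ω) := by
      have := intervalIntegral.integral_comp_add_left (a := 0) (b := ((T - τ ω : ℝ≥0) : ℝ))
        (fun r : ℝ => v (M.X r.toNNReal ω)) (τ ω)
      rw [add_zero, ← NNReal.coe_add, e1] at this
      rw [← this]
      refine intervalIntegral.integral_congr fun r hr => ?_
      rw [uIcc_of_le (NNReal.coe_nonneg _)] at hr
      simp [Real.toNNReal_add (NNReal.coe_nonneg (τ ω)) hr.1]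
    have e3 := intervalIntegral.integral_add_adjacent_intervals
      (hX.intervalIntegrable v 0 (τ ω)) (hX.intervalIntegrable v (τ ω) T)
    change u (M.X (τ ω + (T - τ ω)) ω)
      - (∫ r in (0 : ℝ)..((T - τ ω : ℝ≥0) : ℝ), v (M.X (τ ω + r.toNNReal) ω)) = _
    rw [e1, e2, ← e3]
    ring
  have hright : ∀ ω, ∫ ω', F (τ ω, M.path ω') ∂(M.P (M.X (τ ω) ω)) = u (M.X (τ ω) ω) :=
    fun ω => hmart (T - τ ω) (M.X (τ ω) ω)
  simp only [hleft, hright] at hfreeze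
  -- Passing to the new time costs the Jacobian e^{-f}; this is where the generator e^{-f}L appears.
  have hw : ∀ ω, ∫ r in (0 : ℝ)..τ ω, v (M.X r.toNNReal ω)
      = ∫ r in (0 : ℝ)..t, (v * expComp (-f)) (M.timeChanged f r.toNNReal ω) := by
    intro ω
    have := integral_comp_pathInv (f := f) (M.isRightContinuousPath_X ω) (v * expComp (-f)) t
    rw [mul_assoc, expComp_neg_mul_expComp, mul_one] at this
    exact this.symm
  rw [integral_add, hmart] at hfreeze
  · simp only [hw] at hfreeze
    rw [integral_intervalIntegral_comp (M.measurable_timeChanged f)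
      (M.isRightContinuousPath_timeChanged f)] at hfreeze
    change M.expect (M.timeChanged f) t u x - u x = ∫ r in (0 : ℝ)..t,
      ∫ ω, (v * expComp (-f)) (M.timeChanged f r.toNNReal ω) ∂(M.P x)
    have e : M.expect (M.timeChanged f) t u x = ∫ ω, u (M.X (τ ω) ω) ∂(M.P x) := rfl
    rw [e]
    linarith
  · refine (M.integrable_comp T u x).sub ?_
    refine Integrable.of_bound (C := ‖v‖ * T) ?_ (Eventually.of_forall fun ω =>
      abs_intervalIntegral_comp_le (fun r => M.X r ω) v T)
    exact ((measurable_intervalIntegral_comp M.measurable_X M.isRightContinuousPath_X v).comp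
      measurable_prodMk_left).aestronglyMeasurable
  · refine Integrable.of_bound (C := ‖v‖ * T) ?_ (Eventually.of_forall fun ω => ?_)
    · exact ((measurable_intervalIntegral_comp M.measurable_X M.isRightContinuousPath_X v).comp
        (hτm.prodMk measurable_id)).aestronglyMeasurable
    · refine (abs_intervalIntegral_comp_le (fun r => M.X r ω) v (τ ω)).trans ?_
      gcongr
      exact hτT ω

end TimeChange

end StrongMarkovProcess

/-! ### Contraction semi-groups: orbits, resolvent, dissipativity. -/

section ContractionSemigroup

set_option linter.unusedSectionVars false

variable {E : Type*} [NormedAddCommGroup E] [NormedSpace ℝ E]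

theorem hasDerivWithinAt_Ici_iff_tendsto {F : ℝ → E} {v : E} {t : ℝ} :
    HasDerivWithinAt F v (Ici t) t ↔
      Tendsto (fun h : ℝ≥0 => (h : ℝ)⁻¹ • (F (t + h) - F t)) (𝓝[>] 0) (𝓝 v) := by
  rw [← hasDerivWithinAt_Ioi_iff_Ici, hasDerivWithinAt_iff_tendsto_slope' self_notMem_Ioi]
  constructor
  · intro H
    have h1 : Tendsto (fun h : ℝ≥0 => t + (h : ℝ)) (𝓝[>] 0) (𝓝[>] t) := by
      refine tendsto_nhdsWithin_iff.2 ⟨?_, ?_⟩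
      · have : Continuous fun h : ℝ≥0 => t + (h : ℝ) := by fun_prop
        simpa using (this.tendsto 0).mono_left nhdsWithin_le_nhds
      · filter_upwards [self_mem_nhdsWithin] with h hh
        simpa using hh
    refine (H.comp h1).congr fun h => ?_
    simp [slope_def_module]
  · intro H
    have h1 : Tendsto (fun y : ℝ => (y - t).toNNReal) (𝓝[>] t) (𝓝[>] 0) := by
      refine tendsto_nhdsWithin_iff.2 ⟨?_, ?_⟩
      · have : Continuous fun y : ℝ => (y - t).toNNReal := by fun_prop
        simpa using (this.tendsto t).mono_left nhdsWithin_le_nhds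
      · filter_upwards [self_mem_nhdsWithin] with y hy
        simpa using hy
    refine (H.comp h1).congr' ?_
    filter_upwards [self_mem_nhdsWithin] with y hy
    have : ((y - t).toNNReal : ℝ) = y - t := Real.coe_toNNReal _ (sub_nonneg.2 (le_of_lt hy))
    simp [slope_def_module, this]

/-- A one-parameter semi-group of linear contractions. -/
structure IsContractionSemigroup (T : ℝ≥0 → E →ₗ[ℝ] E) : Prop where
  zero : ∀ u, T 0 u = u
  add : ∀ s t u, T (s + t) u = T s (T t u)
  contractive : ∀ t u, ‖T t u‖ ≤ ‖u‖

namespace IsContractionSemigroup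

variable {T : ℝ≥0 → E →ₗ[ℝ] E} (hT : IsContractionSemigroup T)

include hT

theorem continuous_apply (t : ℝ≥0) : Continuous (T t) :=
  ((T t).mkContinuous 1 fun u => by simpa using hT.contractive t u).continuous

theorem norm_sub_le_of_le {s t : ℝ≥0} (hst : s ≤ t) (u : E) :
    ‖T t u - T s u‖ ≤ ‖T (t - s) u - u‖ := by
  conv_lhs => rw [← add_tsub_cancel_of_le hst, hT.add, ← map_sub]
  exact hT.contractive _ _

theorem tendsto_zero {u : E} (hu : u ∈ strongDomain T) :
    Tendsto (fun t => T t u) (𝓝 0) (𝓝 u) := by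
  have h1 : Tendsto (fun t => T t u) (𝓝[>] 0) (𝓝 u) := hu
  have h2 : Tendsto (fun t => T t u) (pure 0) (𝓝 u) := by
    rw [tendsto_pure_left]
    intro s hs
    rw [hT.zero]
    exact mem_of_mem_nhds hs
  have h3 : 𝓝 (0 : ℝ≥0) = 𝓝[>] 0 ⊔ pure 0 := by
    rw [← nhdsWithin_univ, ← nhdsWithin_singleton, ← nhdsWithin_union]
    congr 1
    ext x
    simp
  rw [h3]
  exact h1.sup h2

theorem isClosed_strongDomain : IsClosed (strongDomain T : Set E) := by
  refine isClosed_of_closure_subset fun u hu => ?_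
  change Tendsto (fun t => T t u) (𝓝[>] 0) (𝓝 u)
  refine Metric.tendsto_nhds.2 fun ε hε => ?_
  obtain ⟨w, hw, huw⟩ := Metric.mem_closure_iff.1 hu (ε / 3) (by positivity)
  have hw' : Tendsto (fun t => T t w) (𝓝[>] 0) (𝓝 w) := hw
  filter_upwards [Metric.tendsto_nhds.1 hw' (ε / 3) (by positivity)] with t ht
  have h1 : dist (T t u) (T t w) ≤ dist u w := by
    rw [dist_eq_norm, dist_eq_norm, ← map_sub]
    exact hT.contractive _ _
  calc dist (T t u) u ≤ dist (T t u) (T t w) + dist (T t w) w + dist w u := dist_triangle4 _ _ _ _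
    _ < ε := by rw [dist_comm w u]; linarith

theorem apply_mem_strongDomain {u : E} (hu : u ∈ strongDomain T) (t : ℝ≥0) :
    T t u ∈ strongDomain T := by
  have h1 : Tendsto (fun s => T s u) (𝓝[>] 0) (𝓝 u) := hu
  refine (((hT.continuous_apply t).tendsto u).comp h1).congr fun s => ?_
  rw [Function.comp_apply, ← hT.add, ← hT.add, add_comm]

/-- Contractivity controls the change of vector, and strong continuity at 0 the change of time. The
elapsed time is max - min because the two times come in either order. -/
theorem continuous_comp {X : Type*} [TopologicalSpace X] {s : X → ℝ≥0} {w : X → E}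
    (hs : Continuous s) (hw : Continuous w) (hwD : ∀ x, w x ∈ strongDomain T) :
    Continuous fun x => T (s x) (w x) := by
  refine continuous_iff_continuousAt.2 fun x₀ => ?_
  refine tendsto_iff_norm_sub_tendsto_zero.2 ?_
  have h1 : Tendsto (fun x => ‖w x - w x₀‖) (𝓝 x₀) (𝓝 0) :=
    tendsto_iff_norm_sub_tendsto_zero.1 (hw.tendsto x₀)
  have h2 : Tendsto (fun x => ‖T (max (s x) (s x₀) - min (s x) (s x₀)) (w x₀) - w x₀‖) (𝓝 x₀)
      (𝓝 0) := by
    refine tendsto_iff_norm_sub_tendsto_zero.1 ((hT.tendsto_zero (hwD x₀)).comp ?_)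
    have : Continuous fun x => max (s x) (s x₀) - min (s x) (s x₀) := by fun_prop
    simpa using this.tendsto x₀
  refine squeeze_zero (fun _ => norm_nonneg _) (fun x => ?_) (by simpa using h1.add h2)
  have e : T (s x) (w x) - T (s x₀) (w x₀)
      = T (s x) (w x - w x₀) + (T (s x) (w x₀) - T (s x₀) (w x₀)) := by
    rw [map_sub]
    abel
  rw [e]
  refine (norm_add_le _ _).trans (add_le_add (hT.contractive _ _) ?_)
  rcases le_total (s x) (s x₀) with h | h
  · rw [max_eq_right h, min_eq_left h, norm_sub_rev]
    exact hT.norm_sub_le_of_le h _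
  · rw [max_eq_left h, min_eq_right h]
    exact hT.norm_sub_le_of_le h _

theorem continuous_orbit {u : E} (hu : u ∈ strongDomain T) : Continuous fun t => T t u :=
  hT.continuous_comp continuous_id continuous_const fun _ => hu

theorem continuous_orbit_real {u : E} (hu : u ∈ strongDomain T) :
    Continuous fun t : ℝ => T t.toNNReal u :=
  (hT.continuous_orbit hu).comp continuous_real_toNNReal

theorem isGeneratorPair_apply {u v : E} (h : IsGeneratorPair T u v) (t : ℝ≥0) :
    IsGeneratorPair T (T t u) (T t v) := by
  refine ⟨hT.apply_mem_strongDomain h.1 t, hT.apply_mem_strongDomain h.2.1 t, ?_⟩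
  refine (((hT.continuous_apply t).tendsto v).comp h.2.2).congr fun s => ?_
  rw [Function.comp_apply, map_smul, map_sub, ← hT.add, ← hT.add, add_comm]

theorem hasDerivWithinAt_orbit {u v : E} (h : IsGeneratorPair T u v) {t : ℝ} (ht : 0 ≤ t) :
    HasDerivWithinAt (fun s : ℝ => T s.toNNReal u) (T t.toNNReal v) (Ici t) t := by
  rw [hasDerivWithinAt_Ici_iff_tendsto]
  refine (hT.isGeneratorPair_apply h t.toNNReal).2.2.congr fun s => ?_
  rw [Real.toNNReal_add ht (NNReal.coe_nonneg s), Real.toNNReal_coe, ← hT.add, add_comm]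

variable [CompleteSpace E]

theorem apply_sub_eq_integral {u v : E} (h : IsGeneratorPair T u v) (t : ℝ≥0) :
    T t u - u = ∫ r in (0 : ℝ)..t, T r.toNNReal v := by
  have := intervalIntegral.integral_eq_sub_of_hasDeriv_right (a := (0 : ℝ)) (b := t)
    (f := fun s : ℝ => T s.toNNReal u) (f' := fun s : ℝ => T s.toNNReal v)
    (hT.continuous_orbit_real h.1).continuousOn
    (fun r hr => (hT.hasDerivWithinAt_orbit h (by simpa using hr.1.le)).mono Ioi_subset_Ici_self)
    ((hT.continuous_orbit_real h.2.1).intervalIntegrable _ _)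
  rw [this]
  simp [hT.zero]

/-- The definition of the generator gives only a right derivative; the integral formula with
continuous integrand gives both sides. Duhamel's formula needs this because it differentiates in t -
s. -/
theorem hasDerivAt_orbit {u v : E} (h : IsGeneratorPair T u v) {t : ℝ} (ht : 0 < t) :
    HasDerivAt (fun s : ℝ => T s.toNNReal u) (T t.toNNReal v) t := by
  have hc := hT.continuous_orbit_real h.2.1
  have h1 : HasDerivAt (fun s : ℝ => u + ∫ r in (0 : ℝ)..s, T r.toNNReal v) (T t.toNNReal v) t :=
    (intervalIntegral.integral_hasDerivAt_right (hc.intervalIntegrable 0 t)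
      (hc.stronglyMeasurableAtFilter _ _) hc.continuousAt).const_add u
  refine h1.congr_of_eventuallyEq ?_
  filter_upwards [lt_mem_nhds ht] with s hs
  have := hT.apply_sub_eq_integral h s.toNNReal
  rw [Real.coe_toNNReal s (le_of_lt hs)] at this
  rw [← this]
  abel

theorem integrable_discounted {u : E} (hu : u ∈ strongDomain T) {c : ℝ} (hc : 0 < c) :
    IntegrableOn (fun s : ℝ => Real.exp (-c * s) • T s.toNNReal u) (Ioi 0) := by
  have h0 : IntegrableOn (fun s : ℝ => Real.exp (-c * s) * ‖u‖) (Ioi 0) :=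
    (integrableOn_exp_mul_Ioi (by linarith) 0).mul_const _
  refine h0.mono' ?_ (Eventually.of_forall fun s => ?_)
  · have : Continuous fun s : ℝ => Real.exp (-c * s) • T s.toNNReal u :=
      Continuous.smul (by fun_prop) (hT.continuous_orbit_real hu)
    exact this.aestronglyMeasurable
  · rw [norm_smul, Real.norm_eq_abs, Real.abs_exp]
    exact mul_le_mul_of_nonneg_left (hT.contractive _ _) (Real.exp_pos _).le

/-- The resolvent equation `c u - A u = h` for the generator `A` of a contraction semi-group. -/
theorem exists_resolvent {h : E} (hh : h ∈ strongDomain T) {c : ℝ} (hc : 0 < c) :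
    ∃ u, IsGeneratorPair T u (c • u - h) := by
  -- The solution is the Laplace transform of the orbit. Shifting the integral gives T_t u =
  -- e^{ct}(u - ∫₀ᵗ e^{-cs} T_s h ds), the function φ below, whose derivative at 0 is cu - h.
  set u : E := ∫ s in Ioi (0 : ℝ), Real.exp (-c * s) • T s.toNNReal h with hu
  have hcont : Continuous fun s : ℝ => Real.exp (-c * s) • T s.toNNReal h :=
    Continuous.smul (by fun_prop) (hT.continuous_orbit_real hh)
  set φ : ℝ → E := fun t =>
    Real.exp (c * t) • (u - ∫ s in (0 : ℝ)..t, Real.exp (-c * s) • T s.toNNReal h) with hφ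
  have hTφ : ∀ t : ℝ≥0, T t u = φ t := by
    intro t
    let Tt : E →L[ℝ] E := (T t).mkContinuous 1 fun u => by simpa using hT.contractive t u
    have e1 : T t u = ∫ s in Ioi (0 : ℝ), Tt (Real.exp (-c * s) • T s.toNNReal h) :=
      (Tt.integral_comp_comm (hT.integrable_discounted hh hc)).symm
    have e2 : ∫ s in Ioi (0 : ℝ), Tt (Real.exp (-c * s) • T s.toNNReal h)
        = ∫ s in Ioi (0 : ℝ), Real.exp (c * t) •
            (Real.exp (-c * (s + t)) • T (s + t).toNNReal h) := by
      refine setIntegral_congr_fun measurableSet_Ioi fun s hs => ?_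
      have : T t (T s.toNNReal h) = T (s + t).toNNReal h := by
        rw [Real.toNNReal_add (le_of_lt hs) (NNReal.coe_nonneg t), Real.toNNReal_coe, add_comm, hT.add]
      simp only [map_smul, smul_smul, ← Real.exp_add]
      change _ • T t (T s.toNNReal h) = _
      rw [this]
      congr 2
      ring
    have e3 : ∫ s in Ioi (0 : ℝ), Real.exp (-c * (s + t)) • T (s + t).toNNReal h
        = ∫ s in Ioi (t : ℝ), Real.exp (-c * s) • T s.toNNReal h := by
      have := (measurePreserving_add_right volume (t : ℝ)).setIntegral_preimage_emb
        (measurableEmbedding_addRight (t : ℝ))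
        (fun s : ℝ => Real.exp (-c * s) • T s.toNNReal h) (Ioi t)
      simpa using this
    have e4 := intervalIntegral.integral_interval_add_Ioi
      (hT.integrable_discounted hh hc)
      ((hT.integrable_discounted hh hc).mono_set (Ioi_subset_Ioi (NNReal.coe_nonneg t)))
    rw [e1, e2, integral_smul, e3, hφ]
    dsimp only
    rw [hu, ← e4, add_sub_cancel_left]
  have hint : HasDerivAt (fun t : ℝ => ∫ s in (0 : ℝ)..t, Real.exp (-c * s) • T s.toNNReal h)
      h 0 := by
    have := intervalIntegral.integral_hasDerivAt_right (hcont.intervalIntegrable 0 0)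
      (hcont.stronglyMeasurableAtFilter _ _) hcont.continuousAt
    simpa [hT.zero] using this
  have hexp : HasDerivAt (fun t : ℝ => Real.exp (c * t)) c 0 := by
    have := ((hasDerivAt_id (0 : ℝ)).const_mul c).exp
    simpa using this
  have hder : HasDerivAt φ (c • u - h) 0 := by
    have := hexp.smul (hint.const_sub u)
    simp only [intervalIntegral.integral_same, mul_zero, Real.exp_zero, sub_zero, one_smul] at this
    rw [neg_add_eq_sub] at this
    exact this
  have hφ0 : φ 0 = u := by simp [hφ]
  have huD : u ∈ strongDomain T := by
    have h1 : Tendsto (fun t : ℝ≥0 => φ t) (𝓝[>] 0) (𝓝 (φ 0)) :=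
      (hder.continuousAt.tendsto.comp
        (NNReal.continuous_coe.tendsto 0)).mono_left nhdsWithin_le_nhds
    rw [hφ0] at h1
    exact h1.congr fun t => (hTφ t).symm
  refine ⟨u, huD, sub_mem (Submodule.smul_mem _ _ huD) hh, ?_⟩
  refine (hasDerivWithinAt_Ici_iff_tendsto.1 hder.hasDerivWithinAt).congr fun t => ?_
  rw [zero_add, hφ0, hTφ]

/-- Replace v by the quotient (T_t u - u)/t: then (c + 1/t)u is the corresponding difference plus
T_t u / t, whose norm is at most ‖u‖/t and cancels. Let t ↓ 0. -/
theorem mul_norm_le_of_isGeneratorPair {u v : E} (h : IsGeneratorPair T u v) (c : ℝ) :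
    c * ‖u‖ ≤ ‖c • u - v‖ := by
  refine ge_of_tendsto (tendsto_const_nhds.sub h.2.2).norm ?_
  filter_upwards [self_mem_nhdsWithin] with t ht
  have ht' : 0 < (t : ℝ)⁻¹ := inv_pos.2 (NNReal.coe_pos.2 ht)
  have e : (c + (t : ℝ)⁻¹) • u = (c • u - (t : ℝ)⁻¹ • (T t u - u)) + (t : ℝ)⁻¹ • T t u := by
    rw [add_smul, smul_sub]
    abel
  have h1 : (c + (t : ℝ)⁻¹) * ‖u‖ ≤ ‖(c + (t : ℝ)⁻¹) • u‖ := by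
    rw [norm_smul]
    exact mul_le_mul_of_nonneg_right (le_abs_self _) (norm_nonneg _)
  have h2 : ‖(t : ℝ)⁻¹ • T t u‖ ≤ (t : ℝ)⁻¹ * ‖u‖ := by
    rw [norm_smul, Real.norm_of_nonneg ht'.le]
    exact mul_le_mul_of_nonneg_left (hT.contractive _ _) ht'.le
  have h3 := norm_add_le (c • u - (t : ℝ)⁻¹ • (T t u - u)) ((t : ℝ)⁻¹ • T t u)
  rw [← e] at h3
  linarith

end IsContractionSemigroup

end ContractionSemigroup

/-! ### The generator of the time-changed semi-group on D(L). -/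

namespace StrongMarkovProcess

section TestAlgebra

set_option linter.unusedSectionVars false

variable {S Ω : Type*} [TopologicalSpace S] [PolishSpace S] [MeasurableSpace S] [BorelSpace S]
  [MeasurableSpace Ω] {M : StrongMarkovProcess S Ω} {G : Subalgebra ℝ (S →ᵇ ℝ)}

theorem isContractionSemigroup (M : StrongMarkovProcess S Ω) :
    IsContractionSemigroup M.semigroup where
  zero u := by
    ext x
    change ∫ ω, u (M.X 0 ω) ∂(M.P x) = u x
    rw [integral_congr_ae (g := fun _ => u x) ((M.start x).mono fun ω hω => by simp only [hω])]
    simp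
  -- The case f = 0 of the time-changed semi-group property.
  add s t u := by
    ext x
    have := M.expect_timeChanged_add 0 s t u.continuous.measurable u.norm_coe_le_norm x
    rw [timeChanged_zero] at this
    exact this
  contractive t u := (BoundedContinuousFunction.norm_le (norm_nonneg u)).2
    (M.abs_expect_le M.X t u)

theorem isGeneratorPair_of_mem_graph {u v : S →ᵇ ℝ} (h : (u, v) ∈ M.L.graph) :
    IsGeneratorPair M.semigroup u v := by
  obtain ⟨y, rfl, rfl⟩ := (LinearPMap.mem_graph_iff M.L).1 h
  exact y.2.choose_spec

theorem applyOrZero_negMulL (f : S →ᵇ ℝ) {u v : S →ᵇ ℝ} (h : IsGeneratorPair M.semigroup u v) :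
    applyOrZero (M.negMulL f) u = -f * v := by
  have hu : u ∈ (M.negMulL f).domain := ⟨v, h⟩
  rw [applyOrZero, dif_pos hu]
  change -f * M.L ⟨u, hu⟩ = -f * v
  congr 1
  exact IsGeneratorPair.unique (Exists.choose_spec (p := IsGeneratorPair M.semigroup u) hu) h

namespace IsTestAlgebra

theorem expComp_mem (hG : M.IsTestAlgebra G) {f : S →ᵇ ℝ} (hf : f ∈ G) : expComp f ∈ G := by
  obtain ⟨k, hk, hkf⟩ := hG.smooth_comp_mem f hf Real.exp Real.contDiff_exp
  rwa [show expComp f = k from BoundedContinuousFunction.ext fun x => (hkf x).symm]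

theorem exists_isGeneratorPair (hG : M.IsTestAlgebra G) {g : S →ᵇ ℝ} (hg : g ∈ G) :
    ∃ k ∈ G, IsGeneratorPair M.semigroup g k := by
  obtain ⟨k, hk, hgk⟩ := hG.L_mem g hg
  exact ⟨k, hk, isGeneratorPair_of_mem_graph hgk⟩

theorem mem_D (hG : M.IsTestAlgebra G) {g : S →ᵇ ℝ} (hg : g ∈ G) : g ∈ M.D := by
  obtain ⟨k, -, h⟩ := hG.exists_isGeneratorPair hg
  exact h.1

end IsTestAlgebra

theorem expect_bcf_sub {f : S →ᵇ ℝ} (t : ℝ≥0) (h k : S →ᵇ ℝ) (x : S) :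
    M.expect (M.timeChanged f) t (h - k : S →ᵇ ℝ) x
      = M.expect (M.timeChanged f) t h x - M.expect (M.timeChanged f) t k x :=
  M.expect_sub (M.measurable_timeChanged f t) h.continuous.measurable k.continuous.measurable
    h.norm_coe_le_norm k.norm_coe_le_norm x

theorem expect_smul {Y : ℝ≥0 → Ω → S} (t : ℝ≥0) (c : ℝ) (h : S →ᵇ ℝ) (x : S) :
    M.expect Y t (c • h : S →ᵇ ℝ) x = c * M.expect Y t h x :=
  integral_const_mul c _

theorem expect_neg {Y : ℝ≥0 → Ω → S} (t : ℝ≥0) (h : S →ᵇ ℝ) (x : S) :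
    M.expect Y t (-h : S →ᵇ ℝ) x = -M.expect Y t h x :=
  integral_neg _

theorem abs_expect_sub_expect_le {f : S →ᵇ ℝ} (t : ℝ≥0) (h k : S →ᵇ ℝ) (x : S) :
    |M.expect (M.timeChanged f) t h x - M.expect (M.timeChanged f) t k x| ≤ ‖h - k‖ := by
  rw [← expect_bcf_sub]
  exact M.abs_expect_le _ t (h - k) x

theorem expect_timeChanged_time_zero (f h : S →ᵇ ℝ) (x : S) :
    M.expect (M.timeChanged f) 0 h x = h x := by
  rw [expect, integral_congr_ae (g := fun _ => h x)
    ((M.timeChanged_start f x).mono fun ω hω => by simp only [hω])]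
  simp

/-- Dominated convergence along the right-continuous time-changed paths; w need not lie in D(P). -/
theorem continuousWithinAt_expect_timeChanged (f w : S →ᵇ ℝ) (x : S) (t : ℝ) :
    ContinuousWithinAt (fun r : ℝ => M.expect (M.timeChanged f) r.toNNReal w x) (Ici t) t := by
  refine tendsto_integral_filter_of_dominated_convergence (fun _ => ‖w‖)
    (Eventually.of_forall fun r => (w.continuous.measurable.comp
      (M.measurable_timeChanged f _)).aestronglyMeasurable)
    (Eventually.of_forall fun r => Eventually.of_forall fun ω => w.norm_coe_le_norm _)
    (integrable_const _) (Eventually.of_forall fun ω => ?_)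
  exact (M.isRightContinuousPath_timeChanged f ω).continuousWithinAt_real w.continuous t

theorem measurable_expect_timeChanged (f w : S →ᵇ ℝ) (x : S) :
    Measurable fun r : ℝ => M.expect (M.timeChanged f) r.toNNReal w x :=
  IsRightContinuousPath.measurable_real (S := ℝ)
    (p := fun t : ℝ≥0 => M.expect (M.timeChanged f) t w x) (h := id)
    (fun t => by
      have h := M.continuousWithinAt_expect_timeChanged f w x t
      have h2 := h.comp (f := fun s : ℝ≥0 => (s : ℝ)) (s := Ici t)
        NNReal.continuous_coe.continuousWithinAt fun s hs => NNReal.coe_le_coe.2 hs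
      simpa [Function.comp_def] using h2) continuous_id

theorem intervalIntegrable_expect_timeChanged (f w : S →ᵇ ℝ) (x : S) (a b : ℝ) :
    IntervalIntegrable (fun r : ℝ => M.expect (M.timeChanged f) r.toNNReal w x) volume a b := by
  rw [intervalIntegrable_iff]
  exact Measure.integrableOn_of_bounded (M := ‖w‖) (by simp)
    (measurable_expect_timeChanged f w x).aestronglyMeasurable
    (Eventually.of_forall fun u => M.abs_expect_le _ _ w x)

/-- Dynkin's formula for functions in the domain of the generator. -/
theorem expect_sub_eq_integral (f : S →ᵇ ℝ) {u v : S →ᵇ ℝ}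
    (h : IsGeneratorPair M.semigroup u v) (t : ℝ≥0) (x : S) :
    M.expect (M.timeChanged f) t u x - u x
      = ∫ r in (0 : ℝ)..t,
          M.expect (M.timeChanged f) r.toNNReal (v * expComp (-f) : S →ᵇ ℝ) x := by
  refine M.expect_timeChanged_sub f u v (fun t y => ?_) t x
  have h1 := M.isContractionSemigroup.apply_sub_eq_integral h t
  have h2 := congrArg (BoundedContinuousFunction.evalCLM ℝ y) h1
  rw [← ContinuousLinearMap.intervalIntegral_comp_comm _
    ((M.isContractionSemigroup.continuous_orbit_real h.2.1).intervalIntegrable _ _)] at h2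
  simpa using h2

theorem abs_expect_sub_expect_le_mul (f : S →ᵇ ℝ) {u v : S →ᵇ ℝ}
    (h : IsGeneratorPair M.semigroup u v) (s t : ℝ≥0) (x : S) :
    |M.expect (M.timeChanged f) t u x - M.expect (M.timeChanged f) s u x|
      ≤ ‖v * expComp (-f)‖ * |(t : ℝ) - s| := by
  have e : M.expect (M.timeChanged f) t u x - M.expect (M.timeChanged f) s u x
      = ∫ r in (s : ℝ)..t,
          M.expect (M.timeChanged f) r.toNNReal (v * expComp (-f) : S →ᵇ ℝ) x := by
    rw [← intervalIntegral.integral_interval_sub_left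
      (intervalIntegrable_expect_timeChanged f _ x 0 t)
      (intervalIntegrable_expect_timeChanged f _ x 0 s), ← expect_sub_eq_integral f h,
      ← expect_sub_eq_integral f h]
    ring
  rw [e]
  exact intervalIntegral.norm_integral_le_of_norm_le_const fun r _ => M.abs_expect_le _ _ _ x

theorem abs_expect_sub_le_mul (f : S →ᵇ ℝ) {u v : S →ᵇ ℝ}
    (h : IsGeneratorPair M.semigroup u v) (t : ℝ≥0) (x : S) :
    |M.expect (M.timeChanged f) t u x - u x| ≤ ‖v * expComp (-f)‖ * t := by
  simpa [expect_timeChanged_time_zero] using abs_expect_sub_expect_le_mul f h 0 t x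

theorem exists_isGeneratorPair_near (hG : M.IsTestAlgebra G) {h : S →ᵇ ℝ} (hh : h ∈ M.D) {ε : ℝ}
    (hε : 0 < ε) : ∃ u v, IsGeneratorPair M.semigroup u v ∧ ‖h - u‖ < ε := by
  obtain ⟨u, hu, hhu⟩ := Metric.mem_closure_iff.1 (hG.dense_D hh) ε hε
  obtain ⟨v, -, huv⟩ := hG.exists_isGeneratorPair hu
  exact ⟨u, v, huv, by rwa [dist_eq_norm] at hhu⟩

/-- Orbits of functions in D(L) are Lipschitz in time, uniformly in x; such functions are dense in
D(P), and P^f is contractive. -/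
theorem exists_pos_forall_abs_expect_sub_le (hG : M.IsTestAlgebra G) (f : S →ᵇ ℝ) {h : S →ᵇ ℝ}
    (hh : h ∈ M.D) {ε : ℝ} (hε : 0 < ε) :
    ∃ δ > 0, ∀ s t : ℝ≥0, |(t : ℝ) - s| ≤ δ → ∀ x,
      |M.expect (M.timeChanged f) t h x - M.expect (M.timeChanged f) s h x| ≤ ε := by
  obtain ⟨u, v, huv, hu⟩ := exists_isGeneratorPair_near hG hh (ε := ε / 3) (by positivity)
  refine ⟨ε / 3 / (‖v * expComp (-f)‖ + 1), by positivity, fun s t hst x => ?_⟩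
  have h1 := abs_expect_sub_expect_le_mul f huv s t x
  have h2 : ‖v * expComp (-f)‖ * |(t : ℝ) - s| ≤ ε / 3 := by
    rw [le_div_iff₀ (by positivity)] at hst
    nlinarith [abs_nonneg ((t : ℝ) - s), norm_nonneg (v * expComp (-f))]
  have h3 := abs_expect_sub_expect_le (M := M) (f := f) t h u x
  have h4 := abs_expect_sub_expect_le (M := M) (f := f) s h u x
  rw [abs_le] at *
  constructor <;> linarith [h1.1, h1.2, h3.1, h3.2, h4.1, h4.2]

theorem tendstoUniformly_expect (hG : M.IsTestAlgebra G) (f : S →ᵇ ℝ) {h : S →ᵇ ℝ}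
    (hh : h ∈ M.D) :
    TendstoUniformly (fun (t : ℝ≥0) x => M.expect (M.timeChanged f) t h x) h (𝓝[>] 0) := by
  refine Metric.tendstoUniformly_iff.2 fun ε hε => ?_
  obtain ⟨δ, hδ, H⟩ := exists_pos_forall_abs_expect_sub_le hG f hh (ε := ε / 2) (by positivity)
  have : ∀ᶠ t : ℝ≥0 in 𝓝[>] 0, (t : ℝ) < δ :=
    ((NNReal.continuous_coe.tendsto 0).mono_left nhdsWithin_le_nhds).eventually
      (gt_mem_nhds (by simpa using hδ))
  filter_upwards [this] with t ht x
  have := H 0 t (by simpa using ht.le) x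
  rw [expect_timeChanged_time_zero] at this
  rw [dist_comm, Real.dist_eq]
  linarith

/-- First-order expansion of the orbit: the remainder is the integral of the oscillation of the
orbit of Au = v e^{-f}. -/
theorem abs_expect_sub_sub_le (f : S →ᵇ ℝ) {u v : S →ᵇ ℝ}
    (h : IsGeneratorPair M.semigroup u v) {ε : ℝ} {t : ℝ≥0} {x : S}
    (H : ∀ s ≤ t, |M.expect (M.timeChanged f) s (v * expComp (-f) : S →ᵇ ℝ) x
      - (v * expComp (-f)) x| ≤ ε) :
    |M.expect (M.timeChanged f) t u x - u x - t * (v * expComp (-f)) x| ≤ ε * t := by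
  have e : M.expect (M.timeChanged f) t u x - u x - t * (v * expComp (-f)) x
      = ∫ r in (0 : ℝ)..t, (M.expect (M.timeChanged f) r.toNNReal (v * expComp (-f) : S →ᵇ ℝ) x
        - (v * expComp (-f)) x) := by
    rw [intervalIntegral.integral_sub (intervalIntegrable_expect_timeChanged f _ x 0 t)
      intervalIntegrable_const, expect_sub_eq_integral f h]
    simp
    ring
  rw [e]
  have := intervalIntegral.norm_integral_le_of_norm_le_const (a := (0 : ℝ)) (b := t) (C := ε)
    (f := fun r => M.expect (M.timeChanged f) r.toNNReal (v * expComp (-f) : S →ᵇ ℝ) x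
        - (v * expComp (-f)) x) fun r hr => H r.toNNReal (by
      rw [uIoc_of_le (NNReal.coe_nonneg t)] at hr
      simpa using Real.toNNReal_le_toNNReal hr.2)
  simpa using this

theorem mul_expComp_mem_D (hG : M.IsTestAlgebra G) {f : S →ᵇ ℝ} (hf : f ∈ G) {v : S →ᵇ ℝ}
    (hv : v ∈ M.D) : v * expComp f ∈ M.D :=
  hG.mul_mem_D _ hv _ (hG.mem_D (hG.expComp_mem hf))

/-- Since D(P) is an algebra, Au = v e^{-f} lies in D(P), so its orbit is equicontinuous at 0 and
the first-order remainder is o(t). -/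
theorem tendstoUniformly_generator (hG : M.IsTestAlgebra G) {f : S →ᵇ ℝ} (hf : f ∈ G)
    {u v : S →ᵇ ℝ} (h : IsGeneratorPair M.semigroup u v) :
    TendstoUniformly (fun (t : ℝ≥0) x => (t : ℝ)⁻¹ * (M.expect (M.timeChanged f) t u x - u x))
      (v * expComp (-f) : S →ᵇ ℝ) (𝓝[>] 0) := by
  refine Metric.tendstoUniformly_iff.2 fun ε hε => ?_
  obtain ⟨δ, hδ, H⟩ := exists_pos_forall_abs_expect_sub_le hG f
    (mul_expComp_mem_D hG (G.neg_mem hf) h.2.1) (ε := ε / 2) (by positivity)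
  have : ∀ᶠ t : ℝ≥0 in 𝓝[>] 0, (t : ℝ) < δ :=
    ((NNReal.continuous_coe.tendsto 0).mono_left nhdsWithin_le_nhds).eventually
      (gt_mem_nhds (by simpa using hδ))
  filter_upwards [this, self_mem_nhdsWithin] with t ht ht0 x
  have ht0' : (0 : ℝ) < t := NNReal.coe_pos.2 ht0
  have h1 := abs_expect_sub_sub_le f h (ε := ε / 2) (t := t) (x := x) fun s hs => by
    have hs' : (s : ℝ) ≤ t := hs
    have := H 0 s (by simpa using hs'.trans ht.le) x
    rwa [expect_timeChanged_time_zero] at this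
  rw [dist_comm, Real.dist_eq]
  have e : (t : ℝ)⁻¹ * (M.expect (M.timeChanged f) t u x - u x) - (v * expComp (-f)) x
      = (t : ℝ)⁻¹ * (M.expect (M.timeChanged f) t u x - u x - t * (v * expComp (-f)) x) := by
    field_simp
  rw [e, abs_mul, abs_of_pos (inv_pos.2 ht0')]
  calc (t : ℝ)⁻¹ * _ ≤ (t : ℝ)⁻¹ * (ε / 2 * t) :=
        mul_le_mul_of_nonneg_left h1 (inv_pos.2 ht0').le
    _ = ε / 2 := by field_simp
    _ < ε := by linarith

/-- Dissipativity of the generator `exp (-f) L` of a time-changed process. -/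
theorem norm_le_norm_sub_smul (hG : M.IsTestAlgebra G) {f : S →ᵇ ℝ} (hf : f ∈ G)
    {u v : S →ᵇ ℝ} (h : IsGeneratorPair M.semigroup u v) {δ : ℝ} (hδ : 0 < δ) :
    ‖u‖ ≤ ‖u - δ • (v * expComp (-f))‖ := by
  refine le_of_forall_pos_le_add fun ε hε => ?_
  have h1 := Metric.tendstoUniformly_iff.1 (tendstoUniformly_generator hG hf h) (ε / δ)
    (by positivity)
  obtain ⟨t, ht, ht0⟩ := (h1.and self_mem_nhdsWithin).exists
  have ht0' : (0 : ℝ) < t := NNReal.coe_pos.2 ht0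
  -- With Q the difference quotient at t, (1 + δ/t)u = (u - δAu) - δ(Q - Au) + (δ/t)P^f_t u. The
  -- choice of t makes the middle term at most ε, and the last is absorbed on the left.
  have key : ∀ x, (1 + δ / t) * |u x|
      ≤ ‖u - δ • (v * expComp (-f))‖ + ε + δ / t * ‖u‖ := by
    intro x
    have h2 := ht x
    rw [dist_comm, Real.dist_eq, lt_div_iff₀ hδ, ← abs_of_pos hδ, ← abs_mul] at h2
    have h3 := (u - δ • (v * expComp (-f))).norm_coe_le_norm x
    have h4 := M.abs_expect_le (M.timeChanged f) t u x
    have h5 : ‖δ / t * M.expect (M.timeChanged f) t u x‖ ≤ δ / t * ‖u‖ := by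
      rw [norm_mul, Real.norm_of_nonneg (by positivity)]
      exact mul_le_mul_of_nonneg_left h4 (by positivity)
    have e : (1 + δ / t) * u x = (u - δ • (v * expComp (-f))) x
        - ((t : ℝ)⁻¹ * (M.expect (M.timeChanged f) t u x - u x) - (v * expComp (-f)) x) * δ
        + δ / t * M.expect (M.timeChanged f) t u x := by
      simp only [BoundedContinuousFunction.sub_apply, BoundedContinuousFunction.smul_apply,
        smul_eq_mul]
      field_simp
      ring
    rw [← abs_of_pos (by positivity : 0 < 1 + δ / t), ← abs_mul, e]
    refine (abs_add_le _ _).trans (add_le_add ((abs_sub _ _).trans (add_le_add h3 h2.le)) h5)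
  have hpos : 0 < 1 + δ / t := by positivity
  have h6 : ‖u‖ ≤ (‖u - δ • (v * expComp (-f))‖ + ε + δ / t * ‖u‖) / (1 + δ / t) := by
    refine (BoundedContinuousFunction.norm_le (by positivity)).2 fun x => ?_
    rw [le_div_iff₀ hpos, mul_comm]
    exact key x
  rw [le_div_iff₀ hpos] at h6
  linarith

end TestAlgebra

end StrongMarkovProcess

/-! ### Resolvents of e^{-f}L and approximation of P^f by their powers. -/

namespace StrongMarkovProcess

section Resolvent

set_option linter.unusedSectionVars false

variable {S Ω : Type*} [TopologicalSpace S] [PolishSpace S] [MeasurableSpace S] [BorelSpace S]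
  [MeasurableSpace Ω] {M : StrongMarkovProcess S Ω} {G : Subalgebra ℝ (S →ᵇ ℝ)}

/-- The resolvent equation `u - δ exp (-f) L u = h`. -/
def IsResolvent (M : StrongMarkovProcess S Ω) (f : S →ᵇ ℝ) (δ : ℝ) (h u : S →ᵇ ℝ) : Prop :=
  ∃ v, IsGeneratorPair M.semigroup u v ∧ u - δ • (v * expComp (-f)) = h

theorem isGeneratorPair_sub {u v u' v' : S →ᵇ ℝ} (h : IsGeneratorPair M.semigroup u v)
    (h' : IsGeneratorPair M.semigroup u' v') : IsGeneratorPair M.semigroup (u - u') (v - v') := by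
  simpa [sub_eq_add_neg] using h.add (h'.smul (-1))

theorem IsResolvent.unique (hG : M.IsTestAlgebra G) {f : S →ᵇ ℝ} (hf : f ∈ G) {δ : ℝ}
    (hδ : 0 < δ) {h u u' : S →ᵇ ℝ} (H : M.IsResolvent f δ h u) (H' : M.IsResolvent f δ h u') :
    u = u' := by
  obtain ⟨v, hv, e⟩ := H
  obtain ⟨v', hv', e'⟩ := H'
  have h1 := norm_le_norm_sub_smul hG hf (isGeneratorPair_sub hv hv') hδ
  have e2 : u - u' - δ • ((v - v') * expComp (-f)) = 0 := by
    rw [sub_mul, smul_sub, sub_sub_sub_comm, e, e', sub_self]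
  rw [e2, norm_zero] at h1
  exact sub_eq_zero.1 (norm_le_zero_iff.1 h1)

theorem norm_exp_sub_expComp_mul_le (f w : S →ᵇ ℝ) :
    ‖Real.exp ‖f‖ • w - w * expComp f‖ ≤ (Real.exp ‖f‖ - Real.exp (-‖f‖)) * ‖w‖ := by
  have h0 : Real.exp (-‖f‖) ≤ Real.exp ‖f‖ :=
    Real.exp_le_exp.2 (by linarith [norm_nonneg f])
  refine (BoundedContinuousFunction.norm_le
    (mul_nonneg (sub_nonneg.2 h0) (norm_nonneg _))).2 fun x => ?_
  have e : (Real.exp ‖f‖ • w - w * expComp f) x = (Real.exp ‖f‖ - Real.exp (f x)) * w x := by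
    simp
    ring
  rw [e, norm_mul, Real.norm_of_nonneg (sub_nonneg.2 (exp_le_exp_norm f x))]
  exact mul_le_mul (sub_le_sub_left (exp_neg_norm_le f x) _) (w.norm_coe_le_norm x)
    (norm_nonneg _) (sub_nonneg.2 h0)

/-- Multiplied by e^f, the equation becomes cu - δLu = (c - e^f)u + e^f h for any c. The choice c =
e^{‖f‖} keeps c - e^f nonnegative, and Φ solves the equation with the right-hand u replaced by w. -/
theorem exists_isResolvent (hG : M.IsTestAlgebra G) {f : S →ᵇ ℝ} (hf : f ∈ G) {δ : ℝ}
    (hδ : 0 < δ) {h : S →ᵇ ℝ} (hh : h ∈ M.D) : ∃ u, M.IsResolvent f δ h u := by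
  set c : ℝ := Real.exp ‖f‖ with hc
  have hcpos : 0 < c := Real.exp_pos _
  have hres : ∀ w : M.D, ∃ u : M.D, IsGeneratorPair M.semigroup u
      ((c / δ) • (u : S →ᵇ ℝ) - δ⁻¹ • ((c • (w : S →ᵇ ℝ) - w * expComp f) + h * expComp f)) := by
    intro w
    obtain ⟨u, hu⟩ := M.isContractionSemigroup.exists_resolvent
      (h := δ⁻¹ • ((c • (w : S →ᵇ ℝ) - w * expComp f) + h * expComp f))
      (Submodule.smul_mem _ _ (add_mem (sub_mem (Submodule.smul_mem _ _ w.2)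
        (mul_expComp_mem_D hG hf w.2)) (mul_expComp_mem_D hG hf hh)))
      (c := c / δ) (by positivity)
    exact ⟨⟨u, hu.1⟩, hu⟩
  choose Φ hΦ using hres
  -- The factor c - e^f is at most c - e^{-‖f‖} in norm, and inverting c - δL costs 1/c.
  set K : ℝ≥0 := ⟨(c - Real.exp (-‖f‖)) / c, div_nonneg (sub_nonneg.2
    (Real.exp_le_exp.2 (by linarith [norm_nonneg f]))) hcpos.le⟩ with hK
  have hKlt : K < 1 := by
    rw [← NNReal.coe_lt_coe, NNReal.coe_one]
    change (c - Real.exp (-‖f‖)) / c < 1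
    rw [div_lt_one hcpos]
    linarith [Real.exp_pos (-‖f‖)]
  have hcontr : ContractingWith K Φ := by
    refine ⟨hKlt, LipschitzWith.of_dist_le_mul fun w w' => ?_⟩
    have h1 := M.isContractionSemigroup.mul_norm_le_of_isGeneratorPair
      (isGeneratorPair_sub (hΦ w) (hΦ w')) (c / δ)
    have e : (c / δ) • ((Φ w : S →ᵇ ℝ) - Φ w')
        - ((c / δ) • (Φ w : S →ᵇ ℝ)
            - δ⁻¹ • ((c • (w : S →ᵇ ℝ) - w * expComp f) + h * expComp f)
          - ((c / δ) • (Φ w' : S →ᵇ ℝ)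
            - δ⁻¹ • ((c • (w' : S →ᵇ ℝ) - w' * expComp f) + h * expComp f)))
        = δ⁻¹ • (c • ((w : S →ᵇ ℝ) - w') - ((w : S →ᵇ ℝ) - w') * expComp f) := by
      simp only [smul_sub, smul_add, sub_mul]
      abel
    rw [e, norm_smul, Real.norm_of_nonneg (inv_pos.2 hδ).le] at h1
    have h2 := norm_exp_sub_expComp_mul_le f ((w : S →ᵇ ℝ) - w')
    rw [← hc] at h2
    have h3 : c / δ * ‖(Φ w : S →ᵇ ℝ) - Φ w'‖
        ≤ δ⁻¹ * ((c - Real.exp (-‖f‖)) * ‖(w : S →ᵇ ℝ) - w'‖) :=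
      h1.trans (mul_le_mul_of_nonneg_left h2 (inv_pos.2 hδ).le)
    rw [Subtype.dist_eq, Subtype.dist_eq, dist_eq_norm, dist_eq_norm]
    change _ ≤ (c - Real.exp (-‖f‖)) / c * _
    rw [div_mul_eq_mul_div, le_div_iff₀ hcpos]
    have h4 : δ * (c / δ * ‖(Φ w : S →ᵇ ℝ) - Φ w'‖)
        ≤ δ * (δ⁻¹ * ((c - Real.exp (-‖f‖)) * ‖(w : S →ᵇ ℝ) - w'‖)) :=
      mul_le_mul_of_nonneg_left h3 hδ.le
    rw [mul_inv_cancel_left₀ hδ.ne', ← mul_assoc, mul_div_cancel₀ _ hδ.ne'] at h4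
    linarith
  have : CompleteSpace M.D :=
    M.isContractionSemigroup.isClosed_strongDomain.completeSpace_coe
  have hfix := hcontr.fixedPoint_isFixedPt
  set u : M.D := ContractingWith.fixedPoint Φ hcontr
  have hu := hΦ u
  rw [hfix] at hu
  refine ⟨u, _, hu, ?_⟩
  ext x
  have hexp : Real.exp (f x) * Real.exp (-f x) = 1 := by rw [← Real.exp_add]; simp
  simp only [BoundedContinuousFunction.sub_apply, BoundedContinuousFunction.smul_apply,
    BoundedContinuousFunction.mul_apply, BoundedContinuousFunction.add_apply, expComp_apply,
    BoundedContinuousFunction.neg_apply, smul_eq_mul]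
  field_simp
  linear_combination ((u : S →ᵇ ℝ) x - h x) * (-1 : ℝ) * hexp

/-- Functions in the domain of the square of `exp (-f) L`, with a bound for its value. -/
def InSquareDomain (M : StrongMarkovProcess S Ω) (f : S →ᵇ ℝ) (C : ℝ) (g : S →ᵇ ℝ) : Prop :=
  ∃ v v', IsGeneratorPair M.semigroup g v ∧
    IsGeneratorPair M.semigroup (v * expComp (-f)) v' ∧ ‖v' * expComp (-f)‖ ≤ C

/-- The resolvent commutes with the generator. -/
theorem IsResolvent.add_smul {f g v u₁ : S →ᵇ ℝ} {δ : ℝ} (hg : IsGeneratorPair M.semigroup g v)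
    (h₁ : M.IsResolvent f δ (v * expComp (-f)) u₁) :
    ∃ z, IsGeneratorPair M.semigroup (g + δ • u₁) z ∧ z * expComp (-f) = u₁
      ∧ M.IsResolvent f δ g (g + δ • u₁) := by
  obtain ⟨z, hz, e⟩ := h₁
  have e2 : (v + δ • z) * expComp (-f) = u₁ := by
    rw [add_mul, smul_mul_assoc, ← e]
    abel
  refine ⟨v + δ • z, hg.add (hz.smul δ), e2, v + δ • z, hg.add (hz.smul δ), ?_⟩
  rw [e2]
  abel

theorem InSquareDomain.resolvent_step (hG : M.IsTestAlgebra G) {f : S →ᵇ ℝ} (hf : f ∈ G)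
    {δ : ℝ≥0} (hδ : 0 < δ) {C : ℝ} {g : S →ᵇ ℝ} (hg : M.InSquareDomain f C g) :
    ∃ u, M.IsResolvent f δ g u ∧ M.InSquareDomain f C u ∧
      ∀ x, |M.expect (M.timeChanged f) δ g x - u x| ≤ 2 * δ ^ 2 * C := by
  have hδ' : (0 : ℝ) < δ := NNReal.coe_pos.2 hδ
  obtain ⟨v, v', hv, hv', hC⟩ := hg
  have hD : ∀ {w : S →ᵇ ℝ}, w ∈ M.D → w * expComp (-f) ∈ M.D :=
    fun hw => mul_expComp_mem_D hG (G.neg_mem hf) hw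
  -- With R = (1 - δA)^{-1} and u₂ = RA²g, one has Rg = g + δAg + δ²u₂ and A²Rg = u₂. Dissipativity
  -- gives ‖u₂‖ ≤ C, so the bound C survives the step.
  obtain ⟨u₂, hu₂⟩ := exists_isResolvent hG hf hδ' (hD hv'.2.1)
  obtain ⟨z₁, hz₁, ez₁, hr₁⟩ := hu₂.add_smul hv'
  obtain ⟨z, hz, ez, hr⟩ := hr₁.add_smul hv
  have hu₂C : ‖u₂‖ ≤ C := by
    obtain ⟨z₂, hz₂, e₂⟩ := hu₂
    have := norm_le_norm_sub_smul hG hf hz₂ hδ'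
    rw [e₂] at this
    exact this.trans hC
  refine ⟨_, hr, ⟨z, z₁, hz, by rwa [ez], by rwa [ez₁]⟩, fun x => ?_⟩
  -- The orbit of Ag is Lipschitz with constant C, so the expansion of P^f_δ g has remainder at most
  -- Cδ²; the term δ²u₂ contributes the other Cδ².
  have h1 := abs_expect_sub_sub_le f hv (ε := C * δ) (t := δ) (x := x) fun s hs => by
    refine (abs_expect_sub_le_mul f hv' s x).trans ?_
    exact mul_le_mul hC (NNReal.coe_le_coe.2 hs) s.2 ((norm_nonneg _).trans hC)
  have h2 : |u₂ x| ≤ C := (u₂.norm_coe_le_norm x).trans hu₂C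
  have e : M.expect (M.timeChanged f) δ g x
        - (g + (δ : ℝ) • (v * expComp (-f) + (δ : ℝ) • u₂)) x
      = (M.expect (M.timeChanged f) δ g x - g x - δ * (v * expComp (-f)) x) - δ ^ 2 * u₂ x := by
    simp only [BoundedContinuousFunction.add_apply, BoundedContinuousFunction.smul_apply,
      smul_eq_mul]
    ring
  rw [e]
  refine (abs_sub _ _).trans ?_
  rw [abs_mul, abs_of_nonneg (by positivity : (0 : ℝ) ≤ (δ : ℝ) ^ 2)]
  have := mul_le_mul_of_nonneg_left h2 (by positivity : (0 : ℝ) ≤ (δ : ℝ) ^ 2)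
  linarith

/-- One-step errors add up because P^f is contractive and C does not grow. The predicate p records
whatever property of g is to be transported to P^f_t g. -/
theorem InSquareDomain.resolvent_iterate (hG : M.IsTestAlgebra G) {f : S →ᵇ ℝ} (hf : f ∈ G)
    {δ : ℝ≥0} (hδ : 0 < δ) {C : ℝ} {p : (S →ᵇ ℝ) → Prop}
    (hp : ∀ h u, p h → M.IsResolvent f δ h u → p u) (n : ℕ) :
    ∀ {g : S →ᵇ ℝ}, M.InSquareDomain f C g → p g →
      ∃ u, p u ∧ ∀ x, |M.expect (M.timeChanged f) (n * δ) g x - u x| ≤ n * (2 * δ ^ 2 * C) := by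
  induction n with
  | zero =>
    intro g _ hpg
    exact ⟨g, hpg, fun x => by simp [expect_timeChanged_time_zero]⟩
  | succ n ih =>
    intro g hg hpg
    obtain ⟨w, hw, hwC, hgw⟩ := hg.resolvent_step hG hf hδ
    obtain ⟨u, hu, hwu⟩ := ih hwC (hp g w hpg hw)
    refine ⟨u, hu, fun x => ?_⟩
    have e : ((n + 1 : ℕ) : ℝ≥0) * δ = n * δ + δ := by push_cast; ring
    rw [e, M.expect_timeChanged_add f _ _ g.continuous.measurable g.norm_coe_le_norm]
    have h1 : |M.expect (M.timeChanged f) (n * δ) (M.expect (M.timeChanged f) δ g) x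
        - M.expect (M.timeChanged f) (n * δ) w x| ≤ 2 * δ ^ 2 * C := by
      rw [← M.expect_sub (M.measurable_timeChanged f _)
        (M.measurable_expect (M.measurable_timeChanged f δ) g.continuous.measurable)
        w.continuous.measurable (M.abs_expect_le _ δ g) w.norm_coe_le_norm]
      exact M.abs_expect_le_of_abs_le _ _ hgw x
    have h2 := hwu x
    push_cast
    rw [abs_le] at *
    constructor <;> linarith [h1.1, h1.2, h2.1, h2.2]

/-- Approximation of the semi-group of a time-changed process by powers of its resolvent. -/
theorem InSquareDomain.exists_near (hG : M.IsTestAlgebra G) {f : S →ᵇ ℝ} (hf : f ∈ G) {C : ℝ}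
    {p : (S →ᵇ ℝ) → Prop}
    (hp : ∀ δ : ℝ, 0 < δ → ∀ h u, p h → M.IsResolvent f δ h u → p u) {g : S →ᵇ ℝ}
    (hg : M.InSquareDomain f C g) (hpg : p g) (t : ℝ≥0) {ε : ℝ} (hε : 0 < ε) :
    ∃ u, p u ∧ ∀ x, |M.expect (M.timeChanged f) t g x - u x| ≤ ε := by
  rcases eq_or_ne t 0 with rfl | ht
  · exact ⟨g, hpg, fun x => by simpa [expect_timeChanged_time_zero] using hε.le⟩
  -- This is the total error n · 2(t/n)²C of n steps of length t/n.
  have hlim : Tendsto (fun n : ℕ => 2 * (t : ℝ) ^ 2 * C / n) atTop (𝓝 0) :=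
    tendsto_const_div_atTop_nhds_zero_nat _
  obtain ⟨n, hn, hn0⟩ := ((hlim.eventually (gt_mem_nhds hε)).and (eventually_gt_atTop 0)).exists
  have hn' : (0 : ℝ≥0) < n := Nat.cast_pos.2 hn0
  have hδ : 0 < t / n := div_pos (pos_iff_ne_zero.2 ht) hn'
  obtain ⟨u, hu, H⟩ := hg.resolvent_iterate hG hf hδ (hp _ (NNReal.coe_pos.2 hδ)) n hpg
  refine ⟨u, hu, fun x => ?_⟩
  have h1 := H x
  rw [mul_div_cancel₀ _ hn'.ne'] at h1
  refine h1.trans (le_trans (le_of_eq ?_) hn.le)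
  have : (n : ℝ) ≠ 0 := by exact_mod_cast hn0.ne'
  push_cast
  field_simp

theorem exists_inSquareDomain (hG : M.IsTestAlgebra G) {f g : S →ᵇ ℝ} (hf : f ∈ G) (hg : g ∈ G) :
    ∃ C, M.InSquareDomain f C g := by
  obtain ⟨v, hv, hgv⟩ := hG.exists_isGeneratorPair hg
  obtain ⟨v', -, hv'⟩ := hG.exists_isGeneratorPair (G.mul_mem hv (hG.expComp_mem (G.neg_mem hf)))
  exact ⟨_, v, v', hgv, hv', le_rfl⟩

theorem exists_mem_D_eq_of_forall_near {F : S → ℝ}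
    (hF : ∀ ε > 0, ∃ u ∈ M.D, ∀ x, |F x - u x| ≤ ε) : ∃ k ∈ M.D, ∀ x, k x = F x := by
  have hcont : Continuous F := by
    refine continuous_of_uniform_approx_of_continuous fun U hU => ?_
    obtain ⟨ε, hε, hεU⟩ := Metric.mem_uniformity_dist.1 hU
    obtain ⟨u, -, hu⟩ := hF (ε / 2) (by positivity)
    refine ⟨u, u.continuous, fun x => hεU ?_⟩
    rw [Real.dist_eq]
    linarith [hu x]
  obtain ⟨u₀, -, hu₀⟩ := hF 1 one_pos
  let k : S →ᵇ ℝ := BoundedContinuousFunction.ofNormedAddCommGroup F hcont (1 + ‖u₀‖) fun x => by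
    have h1 := hu₀ x
    have h2 := u₀.norm_coe_le_norm x
    rw [Real.norm_eq_abs] at *
    calc |F x| = |(F x - u₀ x) + u₀ x| := by rw [sub_add_cancel]
      _ ≤ 1 + ‖u₀‖ := (abs_add_le _ _).trans (add_le_add h1 h2)
  refine ⟨k, ?_, fun x => rfl⟩
  refine M.isContractionSemigroup.isClosed_strongDomain.closure_subset
    (Metric.mem_closure_iff.2 fun ε hε => ?_)
  obtain ⟨u, hu, hku⟩ := hF (ε / 2) (by positivity)
  refine ⟨u, hu, ?_⟩
  rw [dist_eq_norm]
  refine lt_of_le_of_lt ((BoundedContinuousFunction.norm_le (by positivity)).2 fun x => hku x) ?_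
  linarith

/-- Resolvents take values in D(L) ⊆ D(P), and D(P) is closed under uniform limits. -/
theorem expect_timeChanged_mem_D (hG : M.IsTestAlgebra G) {f : S →ᵇ ℝ} (hf : f ∈ G) (t : ℝ≥0)
    {h : S →ᵇ ℝ} (hh : h ∈ M.D) :
    ∃ k ∈ M.D, ∀ x, k x = M.expect (M.timeChanged f) t h x := by
  refine exists_mem_D_eq_of_forall_near fun ε hε => ?_
  obtain ⟨g, hg, hhg⟩ := Metric.mem_closure_iff.1 (hG.dense_D hh) (ε / 2) (by positivity)
  obtain ⟨C, hC⟩ := exists_inSquareDomain hG hf hg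
  obtain ⟨u, hu, H⟩ := hC.exists_near hG hf (p := fun u => u ∈ M.D)
    (fun δ _ h u _ ⟨v, hv, _⟩ => hv.1) (hG.mem_D hg) t (ε := ε / 2) (by positivity)
  refine ⟨u, hu, fun x => ?_⟩
  have h1 := abs_expect_sub_expect_le (M := M) (f := f) t h g x
  have h2 := H x
  rw [dist_eq_norm] at hhg
  rw [abs_le] at *
  constructor <;> linarith [h1.1, h1.2, h2.1, h2.2]

end Resolvent

end StrongMarkovProcess

/-! ### Finite measures are determined by a class dense in every L₂. -/

section MeasureDetermination

variable {S : Type*} [TopologicalSpace S] [MeasurableSpace S] [BorelSpace S]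

/-- Approximate h in L₂ of the normalised sum of the two measures. This controls the L₁ distance,
hence both integrals at once. -/
theorem integral_eq_of_dense_toLp {D : Set (S →ᵇ ℝ)}
    (hD : ∀ (μ : Measure S) [IsProbabilityMeasure μ],
      Dense ((fun h : S →ᵇ ℝ => BoundedContinuousFunction.toLp 2 μ ℝ h) '' D))
    (μ₁ μ₂ : Measure S) [IsFiniteMeasure μ₁] [IsFiniteMeasure μ₂]
    (heq : ∀ h ∈ D, ∫ x, h x ∂μ₁ = ∫ x, h x ∂μ₂) {h : S → ℝ} (hh : Measurable h) {C : ℝ}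
    (hC : ∀ x, |h x| ≤ C) : ∫ x, h x ∂μ₁ = ∫ x, h x ∂μ₂ := by
  set m : Measure S := μ₁ + μ₂ with hm
  set c : ℝ≥0∞ := m univ with hc
  have hctop : c ≠ ∞ := measure_ne_top _ _
  rcases eq_or_ne c 0 with hc0 | hc0
  · have h0 : m = 0 := Measure.measure_univ_eq_zero.1 hc0
    have h1 : μ₁ = 0 := Measure.measure_univ_eq_zero.1 <| by
      have : μ₁ univ + μ₂ univ = 0 := by simpa [hm, hc] using hc0
      exact (add_eq_zero.1 this).1
    have h2 : μ₂ = 0 := Measure.measure_univ_eq_zero.1 <| by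
      have : μ₁ univ + μ₂ univ = 0 := by simpa [hm, hc] using hc0
      exact (add_eq_zero.1 this).2
    rw [h1, h2]
  set ν : Measure S := c⁻¹ • m with hν
  have hprob : IsProbabilityMeasure ν := ⟨by
    rw [hν, Measure.smul_apply, smul_eq_mul, ← hc, ENNReal.inv_mul_cancel hc0 hctop]⟩
  have hmν : m = c • ν := by
    rw [hν, smul_smul, ENNReal.mul_inv_cancel hc0 hctop, one_smul]
  have hint : ∀ (μ : Measure S) [IsFiniteMeasure μ], Integrable h μ := fun μ _ =>
    Integrable.of_bound hh.aestronglyMeasurable C (Eventually.of_forall hC)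
  have hL2 : MemLp h 2 ν :=
    MemLp.of_bound hh.aestronglyMeasurable C (Eventually.of_forall hC)
  have key : ∀ k : S →ᵇ ℝ, ∀ μ : Measure S, IsFiniteMeasure μ → μ ≤ m →
      |∫ x, h x ∂μ - ∫ x, k x ∂μ|
        ≤ c.toReal * dist (hL2.toLp h) (BoundedContinuousFunction.toLp 2 ν ℝ k) := by
    intro k μ _ hμ
    have hik : ∀ (μ : Measure S) [IsFiniteMeasure μ], Integrable (fun x => h x - k x) μ :=
      fun μ _ => (hint μ).sub (k.integrable μ)
    rw [← integral_sub (hint μ) (k.integrable μ), ← Real.norm_eq_abs]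
    calc ‖∫ x, (h x - k x) ∂μ‖ ≤ ∫ x, ‖h x - k x‖ ∂μ := norm_integral_le_integral_norm _
      _ ≤ ∫ x, ‖h x - k x‖ ∂m := integral_mono_measure hμ
          (Eventually.of_forall fun x => norm_nonneg _) (hik m).norm
      _ = c.toReal * ∫ x, ‖h x - k x‖ ∂ν := by rw [hmν, integral_smul_measure, smul_eq_mul]
      _ ≤ c.toReal * dist (hL2.toLp h) (BoundedContinuousFunction.toLp 2 ν ℝ k) := by
        refine mul_le_mul_of_nonneg_left ?_ ENNReal.toReal_nonneg
        have hae : ⇑(hL2.toLp h) - ⇑(BoundedContinuousFunction.toLp 2 ν ℝ k)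
            =ᵐ[ν] fun x => h x - k x := by
          filter_upwards [hL2.coeFn_toLp, BoundedContinuousFunction.coeFn_toLp (p := 2) ν ℝ k]
            with x h1 h2
          rw [Pi.sub_apply, h1, h2]
        rw [Lp.dist_def, eLpNorm_congr_ae hae, integral_norm_eq_lintegral_enorm (hik ν).1,
          ← eLpNorm_one_eq_lintegral_enorm]
        have h2 : MemLp (fun x => h x - k x) 2 ν := (memLp_congr_ae hae).1
          ((Lp.memLp _).sub (Lp.memLp _))
        exact ENNReal.toReal_mono h2.2.ne
          (eLpNorm_le_eLpNorm_of_exponent_le (by norm_num) h2.1)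
  refine eq_of_abs_sub_le_all fun ε hε => ?_
  have hcpos : 0 < c.toReal := ENNReal.toReal_pos hc0 hctop
  obtain ⟨_, ⟨k, hk, rfl⟩, hdist⟩ := Metric.mem_closure_iff.1 (hD ν (hL2.toLp h))
    (ε / 2 / c.toReal) (by positivity)
  have h1 := key k μ₁ inferInstance (Measure.le_add_right le_rfl)
  have h2 := key k μ₂ inferInstance (Measure.le_add_left le_rfl)
  rw [lt_div_iff₀ hcpos] at hdist
  have h3 := heq k hk
  rw [abs_le] at *
  constructor <;> linarith [h1.1, h1.2, h2.1, h2.2]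

end MeasureDetermination

/-! ### Invariance of e^f μ₀. -/

namespace StrongMarkovProcess

section Invariance

set_option linter.unusedSectionVars false

variable {S Ω : Type*} [TopologicalSpace S] [PolishSpace S] [MeasurableSpace S] [BorelSpace S]
  [MeasurableSpace Ω] {M : StrongMarkovProcess S Ω} {G : Subalgebra ℝ (S →ᵇ ℝ)}

/-- Invariance makes every difference quotient integrate to zero, and the quotients converge
uniformly. -/
theorem integral_generator_eq_zero {μ₀ : Measure S} (hμ₀ : M.IsInvariant M.X μ₀)
    {u v : S →ᵇ ℝ} (h : IsGeneratorPair M.semigroup u v) : ∫ x, v x ∂μ₀ = 0 := by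
  have := hμ₀.1
  have h0 : ∀ t : ℝ≥0, ∫ x, ((t : ℝ)⁻¹ • (M.semigroup t u - u)) x ∂μ₀ = 0 := by
    intro t
    have h1 : ∫ x, M.semigroup t u x ∂μ₀ = ∫ x, u x ∂μ₀ :=
      hμ₀.2 u u.continuous.measurable ⟨‖u‖, u.norm_coe_le_norm⟩ t
    simp only [BoundedContinuousFunction.smul_apply, BoundedContinuousFunction.sub_apply,
      smul_eq_mul]
    rw [integral_const_mul, integral_sub ((M.semigroup t u).integrable μ₀) (u.integrable μ₀), h1,
      sub_self, mul_zero]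
  have hlim := (h.2.2.sub_const v).norm.mul_const (μ₀.real univ)
  rw [sub_self, norm_zero, zero_mul] at hlim
  refine norm_le_zero_iff.1 (ge_of_tendsto' hlim fun t => ?_)
  set F := (t : ℝ)⁻¹ • (M.semigroup t u - u)
  have e : ∫ x, v x ∂μ₀ = - ∫ x, (F - v) x ∂μ₀ := by
    simp only [BoundedContinuousFunction.sub_apply]
    rw [integral_sub (F.integrable μ₀) (v.integrable μ₀), h0 t]
    ring
  rw [e, norm_neg]
  exact norm_integral_le_of_norm_le_const (Eventually.of_forall (F - v).norm_coe_le_norm)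

theorem integral_withDensity_expComp (μ₀ : Measure S) (f : S →ᵇ ℝ) (h : S → ℝ) :
    ∫ x, h x ∂(μ₀.withDensity fun x => ENNReal.ofReal (Real.exp (f x)))
      = ∫ x, Real.exp (f x) * h x ∂μ₀ := by
  rw [integral_withDensity_eq_integral_toReal_smul
    (f := fun x => ENNReal.ofReal (Real.exp (f x)))
    (ENNReal.measurable_ofReal.comp (Real.measurable_exp.comp f.continuous.measurable))
    (Eventually.of_forall fun x => ENNReal.ofReal_lt_top)]
  refine integral_congr_ae (Eventually.of_forall fun x => ?_)
  simp [ENNReal.toReal_ofReal (Real.exp_pos _).le]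

theorem isFiniteMeasure_withDensity_expComp (μ₀ : Measure S) [IsFiniteMeasure μ₀] (f : S →ᵇ ℝ) :
    IsFiniteMeasure (μ₀.withDensity fun x => ENNReal.ofReal (Real.exp (f x))) :=
  isFiniteMeasure_withDensity_ofReal ((expComp f).integrable μ₀).2

/-- The density e^f cancels the factor e^{-f} of the generator, leaving the integral of Lu against
μ₀, which vanishes. -/
theorem IsResolvent.integral_eq {μ₀ : Measure S} (hμ₀ : M.IsInvariant M.X μ₀) {f h u : S →ᵇ ℝ}
    {δ : ℝ} (H : M.IsResolvent f δ h u) :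
    ∫ x, u x ∂(μ₀.withDensity fun x => ENNReal.ofReal (Real.exp (f x)))
      = ∫ x, h x ∂(μ₀.withDensity fun x => ENNReal.ofReal (Real.exp (f x))) := by
  have := hμ₀.1
  obtain ⟨v, hv, rfl⟩ := H
  rw [integral_withDensity_expComp, integral_withDensity_expComp]
  have e : ∀ x, Real.exp (f x) * (u - δ • (v * expComp (-f))) x
      = (expComp f * u) x - δ * v x := by
    intro x
    have hexp : Real.exp (f x) * Real.exp (-f x) = 1 := by rw [← Real.exp_add]; simp
    simp only [BoundedContinuousFunction.sub_apply, BoundedContinuousFunction.smul_apply,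
      BoundedContinuousFunction.mul_apply, expComp_apply, BoundedContinuousFunction.neg_apply,
      smul_eq_mul]
    linear_combination (-δ * v x) * hexp
  simp only [e]
  rw [integral_sub ((expComp f * u).integrable μ₀) ((v.integrable μ₀).const_mul δ),
    integral_const_mul, integral_generator_eq_zero hμ₀ hv, mul_zero, sub_zero]
  rfl

theorem integral_expect_of_mem_D (hG : M.IsTestAlgebra G) {μ₀ : Measure S}
    (hμ₀ : M.IsInvariant M.X μ₀) {f : S →ᵇ ℝ} (hf : f ∈ G) (t : ℝ≥0) {h : S →ᵇ ℝ}
    (hh : h ∈ M.D) :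
    ∫ x, M.expect (M.timeChanged f) t h x
        ∂(μ₀.withDensity fun x => ENNReal.ofReal (Real.exp (f x)))
      = ∫ x, h x ∂(μ₀.withDensity fun x => ENNReal.ofReal (Real.exp (f x))) := by
  have := hμ₀.1
  have := isFiniteMeasure_withDensity_expComp μ₀ f
  have hres := fun (h u : S →ᵇ ℝ) (δ : ℝ) (H : M.IsResolvent f δ h u) => H.integral_eq hμ₀
  set μ := μ₀.withDensity fun x => ENNReal.ofReal (Real.exp (f x))
  refine eq_of_abs_sub_le_all fun ε hε => ?_
  set ε' : ℝ := ε / 3 / (μ.real univ + 1) with hε'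
  have hm : 0 ≤ μ.real univ := measureReal_nonneg
  have hε'pos : 0 < ε' := by positivity
  obtain ⟨g, hg, hhg⟩ := Metric.mem_closure_iff.1 (hG.dense_D hh) ε' hε'pos
  rw [dist_eq_norm] at hhg
  obtain ⟨C, hC⟩ := exists_inSquareDomain hG hf hg
  -- The transported property is that the integral stays equal to that of g.
  obtain ⟨u, hu, H⟩ := hC.exists_near hG hf (p := fun u => ∫ x, u x ∂μ = ∫ x, g x ∂μ)
    (fun δ _ h u hp hr => (hres h u δ hr).trans hp) rfl t hε'pos
  have hq : Integrable (M.expect (M.timeChanged f) t h) μ :=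
    Integrable.of_bound (M.measurable_expect (M.measurable_timeChanged f t)
      h.continuous.measurable).aestronglyMeasurable ‖h‖
      (Eventually.of_forall (M.abs_expect_le _ t h))
  have h1 : |∫ x, M.expect (M.timeChanged f) t h x ∂μ - ∫ x, u x ∂μ|
      ≤ 2 * ε' * μ.real univ := by
    rw [← integral_sub hq (u.integrable μ), ← Real.norm_eq_abs]
    refine norm_integral_le_of_norm_le_const (Eventually.of_forall fun x => ?_)
    have h2 := abs_expect_sub_expect_le (M := M) (f := f) t h g x
    have h3 := H x
    rw [Real.norm_eq_abs]
    rw [abs_le] at *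
    constructor <;> linarith [h2.1, h2.2, h3.1, h3.2]
  have h4 : |∫ x, h x ∂μ - ∫ x, g x ∂μ| ≤ ε' * μ.real univ := by
    rw [← integral_sub (h.integrable μ) (g.integrable μ), ← Real.norm_eq_abs]
    refine norm_integral_le_of_norm_le_const (Eventually.of_forall fun x => ?_)
    exact ((h - g).norm_coe_le_norm x).trans hhg.le
  have h5 : ε' * μ.real univ ≤ ε / 3 := by
    rw [hε', div_mul_eq_mul_div, div_le_iff₀ (by positivity)]
    nlinarith
  rw [abs_le] at *
  constructor <;> linarith [h1.1, h1.2, h4.1, h4.2]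

theorem isInvariant_timeChanged (hG : M.IsTestAlgebra G) {μ₀ : Measure S}
    (hμ₀ : M.IsInvariant M.X μ₀) {f : S →ᵇ ℝ} (hf : f ∈ G) :
    M.IsInvariant (M.timeChanged f)
      (μ₀.withDensity fun x => ENNReal.ofReal (Real.exp (f x))) := by
  have := hμ₀.1
  have hfin := isFiniteMeasure_withDensity_expComp μ₀ f
  have hD := fun (t : ℝ≥0) (h : S →ᵇ ℝ) (hh : h ∈ M.D) => integral_expect_of_mem_D hG hμ₀ hf t hh
  set μ := μ₀.withDensity fun x => ENNReal.ofReal (Real.exp (f x))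
  refine ⟨hfin, fun h hh ⟨C, hC⟩ t => ?_⟩
  have hY := M.measurable_timeChanged f t
  let κ : Kernel S S := M.P.map (M.timeChanged f t)
  have hκ : IsMarkovKernel κ := Kernel.IsMarkovKernel.map _ hY
  -- Invariance becomes the equality of two finite measures, the law after time t and μ itself,
  -- which can be tested on D(P).
  have hbind : ∀ (k : S → ℝ), Measurable k → ∀ C : ℝ, (∀ x, |k x| ≤ C) →
      ∫ x, k x ∂(μ.bind κ) = ∫ x, M.expect (M.timeChanged f) t k x ∂μ := by
    intro k hk C hC
    rw [← Measure.snd_compProd, Measure.snd, integral_map measurable_snd.aemeasurable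
      hk.aestronglyMeasurable, Measure.integral_compProd (f := fun x : S × S => k x.2)
        (Integrable.of_bound
        (hk.comp measurable_snd).aestronglyMeasurable C (Eventually.of_forall fun x => hC x.2))]
    refine integral_congr_ae (Eventually.of_forall fun x => ?_)
    simp only [κ]
    rw [Kernel.map_apply _ hY, integral_map hY.aemeasurable hk.aestronglyMeasurable]
    rfl
  rw [← hbind h hh C hC]
  refine integral_eq_of_dense_toLp (D := M.D) hG.dense_L2 _ _ (fun k hk => ?_) hh hC
  rw [hbind k k.continuous.measurable _ k.norm_coe_le_norm, hD t k hk]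

end Invariance

end StrongMarkovProcess

/-! ### Duhamel's formula and the linear response. -/

namespace StrongMarkovProcess

section Duhamel

set_option linter.unusedSectionVars false

variable {S Ω : Type*} [TopologicalSpace S] [PolishSpace S] [MeasurableSpace S] [BorelSpace S]
  [MeasurableSpace Ω] {M : StrongMarkovProcess S Ω} {G : Subalgebra ℝ (S →ᵇ ℝ)}

theorem continuous_expect_comp (hG : M.IsTestAlgebra G) (f : S →ᵇ ℝ) (x : S) {s : ℝ → ℝ≥0}
    {w : ℝ → S →ᵇ ℝ} (hs : Continuous s) (hw : Continuous w) (hwD : ∀ r, w r ∈ M.D) :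
    Continuous fun r => M.expect (M.timeChanged f) (s r) (w r) x := by
  refine Metric.continuous_iff'.2 fun r₀ ε hε => ?_
  obtain ⟨δ, hδ, H⟩ := exists_pos_forall_abs_expect_sub_le hG f (hwD r₀) (ε := ε / 2)
    (by positivity)
  have h1 : ∀ᶠ r in 𝓝 r₀, dist (s r) (s r₀) < δ := Metric.continuous_iff'.1 hs r₀ δ hδ
  have h2 : ∀ᶠ r in 𝓝 r₀, dist (w r) (w r₀) < ε / 2 :=
    Metric.continuous_iff'.1 hw r₀ _ (by positivity)
  filter_upwards [h1, h2] with r hr1 hr2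
  have h3 := H (s r₀) (s r) (by rw [← NNReal.dist_eq]; exact hr1.le) x
  have h4 := abs_expect_sub_expect_le (M := M) (f := f) (s r) (w r) (w r₀) x
  rw [dist_eq_norm] at hr2
  rw [Real.dist_eq]
  refine lt_of_le_of_lt (abs_sub_le _ (M.expect (M.timeChanged f) (s r) (w r₀) x) _) ?_
  linarith

theorem hasDerivWithinAt_expect (f : S →ᵇ ℝ) {u v : S →ᵇ ℝ}
    (h : IsGeneratorPair M.semigroup u v) (x : S) {t : ℝ} (ht : 0 ≤ t) :
    HasDerivWithinAt (fun r : ℝ => M.expect (M.timeChanged f) r.toNNReal u x)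
      (M.expect (M.timeChanged f) t.toNNReal (v * expComp (-f) : S →ᵇ ℝ) x) (Ici t) t := by
  have h1 : HasDerivWithinAt (fun r : ℝ => u x + ∫ r in (0 : ℝ)..r,
      M.expect (M.timeChanged f) r.toNNReal (v * expComp (-f) : S →ᵇ ℝ) x)
      (M.expect (M.timeChanged f) t.toNNReal (v * expComp (-f) : S →ᵇ ℝ) x) (Ici t) t :=
    (intervalIntegral.integral_hasDerivWithinAt_right (s := Ici t) (t := Ioi t)
      (intervalIntegrable_expect_timeChanged f _ x 0 t)
      (measurable_expect_timeChanged f _ x).stronglyMeasurable.stronglyMeasurableAtFilter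
      ((continuousWithinAt_expect_timeChanged f _ x t).mono Ioi_subset_Ici_self)).const_add (u x)
  refine h1.congr_of_mem (fun r hr => ?_) self_mem_Ici
  have hr0 : 0 ≤ r := ht.trans hr
  have := expect_sub_eq_integral f h r.toNNReal x
  rw [Real.coe_toNNReal r hr0] at this
  rw [← this]
  ring

/-- Duhamel's formula for a time-changed process. -/
theorem expect_sub_semigroup_eq_integral (hG : M.IsTestAlgebra G) {f : S →ᵇ ℝ} (hf : f ∈ G)
    {k v : S →ᵇ ℝ} (h : IsGeneratorPair M.semigroup k v) (t : ℝ≥0) (x : S) :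
    M.expect (M.timeChanged f) t k x - M.semigroup t k x
      = ∫ s in (0 : ℝ)..t, M.expect (M.timeChanged f) s.toNNReal
          (M.semigroup (t - s).toNNReal v * expComp (-f) - M.semigroup (t - s).toNNReal v
            : S →ᵇ ℝ) x := by
  have hT := M.isContractionSemigroup
  -- The interpolation P^f_s P_{t-s} k runs from P_t k at s = 0 to P^f_t k at s = t.
  set φ : ℝ → ℝ := fun s =>
    M.expect (M.timeChanged f) s.toNNReal (M.semigroup (t - s).toNNReal k) x with hφ
  have hsub : Continuous fun s : ℝ => ((t : ℝ) - s).toNNReal := by fun_prop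
  have hkc : Continuous fun s : ℝ => M.semigroup ((t : ℝ) - s).toNNReal k :=
    (hT.continuous_orbit h.1).comp hsub
  have hvc : Continuous fun s : ℝ => M.semigroup ((t : ℝ) - s).toNNReal v :=
    (hT.continuous_orbit h.2.1).comp hsub
  have hvD : ∀ s : ℝ, M.semigroup ((t : ℝ) - s).toNNReal v ∈ M.D :=
    fun s => hT.apply_mem_strongDomain h.2.1 _
  have hder : ∀ s ∈ Ioo (min 0 (t : ℝ)) (max 0 (t : ℝ)), HasDerivWithinAt φ
      (M.expect (M.timeChanged f) s.toNNReal
        (M.semigroup (t - s).toNNReal v * expComp (-f) - M.semigroup (t - s).toNNReal v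
          : S →ᵇ ℝ) x) (Ioi s) s := by
    intro s hs
    rw [min_eq_left (NNReal.coe_nonneg t), max_eq_right (NNReal.coe_nonneg t)] at hs
    refine HasDerivWithinAt.mono ?_ Ioi_subset_Ici_self
    set z := M.semigroup ((t : ℝ) - s).toNNReal v with hz
    have h1 := hasDerivWithinAt_Ici_iff_tendsto.1 (hasDerivWithinAt_expect (M := M) f
      (hT.isGeneratorPair_apply h ((t : ℝ) - s).toNNReal) x hs.1.le)
    have h2 : HasDerivAt (fun r : ℝ => M.semigroup ((t : ℝ) - r).toNNReal k) (-z) s := by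
      have := (hT.hasDerivAt_orbit h (sub_pos.2 hs.2)).scomp s
        ((hasDerivAt_id s).const_sub (t : ℝ))
      simpa [Function.comp_def] using this
    have h3 := hasDerivWithinAt_Ici_iff_tendsto.1 (h2.hasDerivWithinAt (s := Ici s))
    -- The second half of the product rule: the quotient of P_{t-s} k converges in norm to -z while
    -- P^f is taken at the moving time s + a, so contractivity and right continuity in time suffice.
    have h4 : Tendsto (fun a : ℝ≥0 => M.expect (M.timeChanged f) (s + a).toNNReal
        ((a : ℝ)⁻¹ • (M.semigroup ((t : ℝ) - (s + a)).toNNReal k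
          - M.semigroup ((t : ℝ) - s).toNNReal k) : S →ᵇ ℝ) x) (𝓝[>] 0)
        (𝓝 (M.expect (M.timeChanged f) s.toNNReal (-z : S →ᵇ ℝ) x)) := by
      have h5 : Tendsto (fun a : ℝ≥0 =>
          M.expect (M.timeChanged f) (s + a).toNNReal (-z : S →ᵇ ℝ) x) (𝓝[>] 0)
          (𝓝 (M.expect (M.timeChanged f) s.toNNReal (-z : S →ᵇ ℝ) x)) := by
        have hadd : Tendsto (fun a : ℝ≥0 => s + (a : ℝ)) (𝓝[>] 0) (𝓝[≥] s) := by
          refine tendsto_nhdsWithin_iff.2 ⟨?_, Eventually.of_forall fun a => ?_⟩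
          · have : Continuous fun a : ℝ≥0 => s + (a : ℝ) := by fun_prop
            simpa using (this.tendsto 0).mono_left nhdsWithin_le_nhds
          · simp
        exact (continuousWithinAt_expect_timeChanged (M := M) f (-z) x s).tendsto.comp hadd
      have h6 := tendsto_iff_norm_sub_tendsto_zero.1 h3
      refine tendsto_of_tendsto_of_dist h5 (squeeze_zero (fun _ => dist_nonneg) (fun a => ?_) h6)
      rw [dist_comm, Real.dist_eq]
      exact abs_expect_sub_expect_le _ _ _ x
    rw [hasDerivWithinAt_Ici_iff_tendsto]
    have h7 := h1.add h4
    have e : M.expect (M.timeChanged f) s.toNNReal (z * expComp (-f) - z : S →ᵇ ℝ) x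
        = M.expect (M.timeChanged f) s.toNNReal (z * expComp (-f) : S →ᵇ ℝ) x
          + M.expect (M.timeChanged f) s.toNNReal (-z : S →ᵇ ℝ) x := by
      rw [expect_bcf_sub, expect_neg, sub_eq_add_neg]
    rw [e]
    refine h7.congr fun a => ?_
    rw [expect_smul, expect_bcf_sub, smul_eq_mul, smul_eq_mul, hφ]
    ring
  have hint := intervalIntegral.integral_eq_sub_of_hasDeriv_right (a := (0 : ℝ)) (b := t)
    (f := φ) (continuous_expect_comp hG f x continuous_real_toNNReal hkc
      fun s => hT.apply_mem_strongDomain h.1 _).continuousOn hder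
    ((continuous_expect_comp hG f x continuous_real_toNNReal
      (w := fun s : ℝ => M.semigroup ((t : ℝ) - s).toNNReal v * expComp (-f)
        - M.semigroup ((t : ℝ) - s).toNNReal v) ((hvc.mul continuous_const).sub hvc)
      fun s => sub_mem (mul_expComp_mem_D hG (G.neg_mem hf) (hvD s)) (hvD s)).intervalIntegrable
        _ _)
  rw [hint, hφ]
  simp [expect_timeChanged_time_zero, hT.zero]

theorem norm_mul_expComp_sub_le (f z : S →ᵇ ℝ) :
    ‖z * expComp (-f) - z‖ ≤ ‖expComp (-f) - 1‖ * ‖z‖ := by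
  have : z * expComp (-f) - z = (expComp (-f) - 1) * z := by ring
  rw [this]
  exact norm_mul_le _ _

theorem abs_expect_sub_semigroup_le (hG : M.IsTestAlgebra G) {f : S →ᵇ ℝ} (hf : f ∈ G)
    {k v : S →ᵇ ℝ} (h : IsGeneratorPair M.semigroup k v) (t : ℝ≥0) (x : S) :
    |M.expect (M.timeChanged f) t k x - M.semigroup t k x|
      ≤ ‖expComp (-f) - 1‖ * ‖v‖ * t := by
  rw [expect_sub_semigroup_eq_integral hG hf h]
  have := intervalIntegral.norm_integral_le_of_norm_le_const (a := (0 : ℝ)) (b := t)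
    (C := ‖expComp (-f) - 1‖ * ‖v‖) (f := fun s : ℝ => M.expect (M.timeChanged f) s.toNNReal
      (M.semigroup (t - s).toNNReal v * expComp (-f) - M.semigroup (t - s).toNNReal v
        : S →ᵇ ℝ) x) fun s _ => by
    refine (M.abs_expect_le _ _ _ x).trans ((norm_mul_expComp_sub_le f _).trans ?_)
    exact mul_le_mul_of_nonneg_left (M.isContractionSemigroup.contractive _ _) (norm_nonneg _)
  simpa using this

theorem tendsto_norm_expComp_neg_smul_sub_one (f : S →ᵇ ℝ) :
    Tendsto (fun δ : ℝ => ‖expComp (-(δ • f)) - 1‖) (𝓝[>] 0) (𝓝 0) := by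
  have hlim : Tendsto (fun δ : ℝ => 2 * (δ * ‖f‖)) (𝓝[>] 0) (𝓝 0) := by
    have : Continuous fun δ : ℝ => 2 * (δ * ‖f‖) := by fun_prop
    simpa using (this.tendsto 0).mono_left nhdsWithin_le_nhds
  refine squeeze_zero' (Eventually.of_forall fun _ => norm_nonneg _) ?_ hlim
  filter_upwards [self_mem_nhdsWithin, hlim.eventually (gt_mem_nhds one_pos)] with δ hδ h1
  have hδ' : (0 : ℝ) < δ := hδ
  refine (BoundedContinuousFunction.norm_le (by positivity)).2 fun x => ?_
  have h2 : |-(δ * f x)| ≤ δ * ‖f‖ := by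
    rw [abs_neg, abs_mul, abs_of_pos hδ']
    exact mul_le_mul_of_nonneg_left (f.norm_coe_le_norm x) hδ'.le
  have h0 : 0 ≤ δ * ‖f‖ := by positivity
  have h3 := Real.abs_exp_sub_one_le (x := -(δ * f x)) (by linarith)
  exact h3.trans (by linarith)

theorem tendsto_norm_inv_smul_expComp_neg_smul_sub_one_add (f : S →ᵇ ℝ) :
    Tendsto (fun δ : ℝ => ‖δ⁻¹ • (expComp (-(δ • f)) - 1) + f‖) (𝓝[>] 0) (𝓝 0) := by
  have hlim : Tendsto (fun δ : ℝ => δ * ‖f‖) (𝓝[>] 0) (𝓝 0) := by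
    have : Continuous fun δ : ℝ => δ * ‖f‖ := by fun_prop
    simpa using (this.tendsto 0).mono_left nhdsWithin_le_nhds
  have hlim2 : Tendsto (fun δ : ℝ => δ * ‖f‖ * ‖f‖) (𝓝[>] 0) (𝓝 0) := by
    simpa using hlim.mul_const ‖f‖
  refine squeeze_zero' (Eventually.of_forall fun _ => norm_nonneg _) ?_ hlim2
  filter_upwards [self_mem_nhdsWithin, hlim.eventually (gt_mem_nhds one_pos)] with δ hδ h1
  have hδ' : (0 : ℝ) < δ := hδ
  refine (BoundedContinuousFunction.norm_le (by positivity)).2 fun x => ?_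
  have hf := f.norm_coe_le_norm x
  have h2 : |-(δ * f x)| ≤ δ * ‖f‖ := by
    rw [abs_neg, abs_mul, abs_of_pos hδ']
    exact mul_le_mul_of_nonneg_left hf hδ'.le
  have h3 := Real.abs_exp_sub_one_sub_id_le (x := -(δ * f x)) (by linarith)
  have e : (δ⁻¹ • (expComp (-(δ • f)) - 1) + f) x
      = δ⁻¹ * (Real.exp (-(δ * f x)) - 1 - -(δ * f x)) := by
    simp
    field_simp
  rw [e, norm_mul, Real.norm_of_nonneg (inv_pos.2 hδ').le, inv_mul_le_iff₀ hδ']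
  refine h3.trans ?_
  rw [← sq_abs]
  calc |-(δ * f x)| ^ 2 ≤ (δ * ‖f‖) ^ 2 := by gcongr
    _ = δ * (δ * ‖f‖ * ‖f‖) := by ring

/-- Convergence of the semi-groups of `δ • f`-changed processes as `δ → 0`, uniformly on compact
families of functions. -/
theorem eventually_forall_abs_expect_sub_semigroup_le (hG : M.IsTestAlgebra G) {f : S →ᵇ ℝ}
    (hf : f ∈ G) {W : ℝ → S →ᵇ ℝ} (hW : Continuous W) (hWD : ∀ r, W r ∈ M.D) {K : Set ℝ}
    (hK : IsCompact K) (T : ℝ≥0) {ε : ℝ} (hε : 0 < ε) :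
    ∀ᶠ δ : ℝ in 𝓝[>] 0, ∀ r ∈ K, ∀ s ≤ T, ∀ x,
      |M.expect (M.timeChanged (δ • f)) s (W r) x - M.semigroup s (W r) x| ≤ ε := by
  -- By compactness a local claim suffices: near r₀ all W r are close to one u in D(L), for which
  -- Duhamel's formula gives a bound tending to zero with δ.
  refine hK.induction_on (p := fun K => ∀ᶠ δ : ℝ in 𝓝[>] 0, ∀ r ∈ K, ∀ s ≤ T, ∀ x,
    |M.expect (M.timeChanged (δ • f)) s (W r) x - M.semigroup s (W r) x| ≤ ε) (by simp)
    (fun K K' hKK' h => h.mono fun δ hδ r hr => hδ r (hKK' hr))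
    (fun K K' h h' => (h.and h').mono fun δ hδ r hr => hr.elim (hδ.1 r) (hδ.2 r))
    fun r₀ _ => ?_
  obtain ⟨u, v, huv, hu⟩ := exists_isGeneratorPair_near hG (hWD r₀) (ε := ε / 3) (by positivity)
  refine ⟨{r | ‖W r - u‖ < ε / 3}, mem_nhdsWithin_of_mem_nhds ?_, ?_⟩
  · have : Continuous fun r => ‖W r - u‖ := (hW.sub continuous_const).norm
    exact (this.tendsto r₀).eventually (gt_mem_nhds hu)
  have hlim : Tendsto (fun δ : ℝ => ‖expComp (-(δ • f)) - 1‖ * ‖v‖ * T) (𝓝[>] 0) (𝓝 0) := by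
    simpa using ((tendsto_norm_expComp_neg_smul_sub_one f).mul_const ‖v‖).mul_const (T : ℝ)
  filter_upwards [hlim.eventually (gt_mem_nhds (by positivity : 0 < ε / 3))] with δ hδ r hr s hs x
  have hr' : ‖W r - u‖ < ε / 3 := hr
  have h1 := abs_expect_sub_semigroup_le hG (G.smul_mem hf δ) huv s x
  have h2 : ‖expComp (-(δ • f)) - 1‖ * ‖v‖ * s ≤ ‖expComp (-(δ • f)) - 1‖ * ‖v‖ * T :=
    mul_le_mul_of_nonneg_left (NNReal.coe_le_coe.2 hs) (by positivity)
  have h3 := abs_expect_sub_expect_le (M := M) (f := δ • f) s (W r) u x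
  have h4 : |M.semigroup s (W r) x - M.semigroup s u x| ≤ ‖W r - u‖ := by
    have := (M.semigroup s (W r - u)).norm_coe_le_norm x
    rw [map_sub] at this
    refine this.trans ?_
    rw [← map_sub]
    exact M.isContractionSemigroup.contractive _ _
  rw [abs_le] at *
  constructor <;> linarith [h1.1, h1.2, h3.1, h3.2, h4.1, h4.2]

/-- The modulus is the supremum over i. The bound B makes it a genuine supremum for every δ, not
only for small ones. -/
theorem exists_tendsto_zero_bound {ι : Type*} {F : ℝ → ι → ℝ}
    (hF : ∀ δ i, 0 ≤ F δ i) {B : ℝ} (hB : ∀ δ i, F δ i ≤ B)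
    (h : ∀ ε > 0, ∀ᶠ δ in 𝓝[>] (0 : ℝ), ∀ i, F δ i ≤ ε) :
    ∃ η : ℝ → ℝ, Tendsto η (𝓝[>] 0) (𝓝 0) ∧ ∀ δ i, F δ i ≤ η δ := by
  refine ⟨fun δ => ⨆ i, F δ i, ?_, fun δ i => le_ciSup ⟨B, forall_mem_range.2 (hB δ)⟩ i⟩
  refine Metric.tendsto_nhds.2 fun ε hε => ?_
  filter_upwards [h (ε / 2) (by positivity)] with δ hδ
  rw [Real.dist_0_eq_abs, abs_of_nonneg (Real.iSup_nonneg (hF δ))]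
  exact lt_of_le_of_lt (Real.iSup_le hδ (by positivity)) (by linarith)

theorem response_negMulL (f : S →ᵇ ℝ) {k v : S →ᵇ ℝ} (h : IsGeneratorPair M.semigroup k v)
    (s t : ℝ) :
    M.response (M.negMulL f) k s t
      = M.semigroup s.toNNReal (-f * M.semigroup (t - s).toNNReal v) := by
  rw [response, applyOrZero_negMulL f (M.isContractionSemigroup.isGeneratorPair_apply h _)]

theorem continuous_response (hG : M.IsTestAlgebra G) {f : S →ᵇ ℝ} (hf : f ∈ G) {k v : S →ᵇ ℝ}
    (h : IsGeneratorPair M.semigroup k v) (t : ℝ) :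
    Continuous fun s => M.response (M.negMulL f) k s t := by
  have hT := M.isContractionSemigroup
  simp only [response_negMulL f h]
  refine hT.continuous_comp continuous_real_toNNReal (continuous_const.mul
    ((hT.continuous_orbit h.2.1).comp (by fun_prop))) fun s => ?_
  exact hG.mul_mem_D _ (hG.mem_D (G.neg_mem hf)) _ (hT.apply_mem_strongDomain h.2.1 _)

/-- The linear response estimate. -/
theorem exists_response_bound (hG : M.IsTestAlgebra G) {f : S →ᵇ ℝ} (hf : f ∈ G) {k v : S →ᵇ ℝ}
    (h : IsGeneratorPair M.semigroup k v) (T : ℝ≥0) :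
    ∃ η : ℝ → ℝ, Tendsto η (𝓝[>] 0) (𝓝 0) ∧
      ∀ δ : ℝ, 0 < δ → ∀ t : ℝ≥0, t ≤ T → ∀ x : S,
        |δ⁻¹ * (M.expect (M.timeChanged (δ • f)) t k x - M.semigroup t k x)
          - (∫ s in (0 : ℝ)..t, M.response (M.negMulL f) k s t) x| ≤ η δ * t := by
  have hT := M.isContractionSemigroup
  -- With r = t - s ∈ [0, T], this one compact family serves all t ≤ T, so the modulus does not
  -- depend on t.
  set W : ℝ → S →ᵇ ℝ := fun r => f * M.semigroup r.toNNReal v with hW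
  have hWc : Continuous W := continuous_const.mul (hT.continuous_orbit_real h.2.1)
  have hWD : ∀ r, W r ∈ M.D := fun r =>
    hG.mul_mem_D _ (hG.mem_D hf) _ (hT.apply_mem_strongDomain h.2.1 _)
  have hWb : ∀ r, ‖W r‖ ≤ ‖f‖ * ‖v‖ := fun r => (norm_mul_le _ _).trans
    (mul_le_mul_of_nonneg_left (hT.contractive _ _) (norm_nonneg _))
  obtain ⟨η, hη, hηF⟩ := exists_tendsto_zero_bound
    (ι := (Icc (0 : ℝ) T) × (Iic T) × S)
    (F := fun δ i => |M.expect (M.timeChanged (δ • f)) i.2.1 (W i.1) i.2.2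
      - M.semigroup i.2.1 (W i.1) i.2.2|) (fun _ _ => abs_nonneg _)
    (B := ‖f‖ * ‖v‖ + ‖f‖ * ‖v‖) (fun δ i => (abs_sub _ _).trans (add_le_add
      ((M.abs_expect_le _ _ _ _).trans (hWb _)) ((M.abs_expect_le _ _ _ _).trans (hWb _))))
    fun ε hε => (eventually_forall_abs_expect_sub_semigroup_le hG hf hWc hWD
      (isCompact_Icc (a := (0 : ℝ)) (b := T)) T hε).mono
        fun δ hδ i => hδ i.1 i.1.2 i.2.1 i.2.1.2 i.2.2
  -- The first term is the error of replacing (e^{-δf} - 1)/δ by -f, the second that of replacing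
  -- P^{δf}_s by P_s.
  refine ⟨fun δ => ‖δ⁻¹ • (expComp (-(δ • f)) - 1) + f‖ * ‖v‖ + η δ, ?_, fun δ hδ t ht x => ?_⟩
  · simpa using ((tendsto_norm_inv_smul_expComp_neg_smul_sub_one_add f).mul_const ‖v‖).add hη
  have hvc : Continuous fun s : ℝ => M.semigroup ((t : ℝ) - s).toNNReal v :=
    (hT.continuous_orbit h.2.1).comp (by fun_prop)
  have hvD : ∀ s : ℝ, M.semigroup ((t : ℝ) - s).toNNReal v ∈ M.D :=
    fun s => hT.apply_mem_strongDomain h.2.1 _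
  have hδf : δ • f ∈ G := G.smul_mem hf δ
  have hR := continuous_response hG hf h t
  have e1 : (∫ s in (0 : ℝ)..t, M.response (M.negMulL f) k s t) x
      = ∫ s in (0 : ℝ)..t, M.response (M.negMulL f) k s t x :=
    (ContinuousLinearMap.intervalIntegral_comp_comm (BoundedContinuousFunction.evalCLM ℝ x)
      (hR.intervalIntegrable 0 t)).symm
  have hRx : Continuous fun s : ℝ => M.response (M.negMulL f) k s t x :=
    (BoundedContinuousFunction.evalCLM ℝ x).continuous.comp hR
  have hQ : Continuous fun s : ℝ => M.expect (M.timeChanged (δ • f)) s.toNNReal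
      (M.semigroup (t - s).toNNReal v * expComp (-(δ • f)) - M.semigroup (t - s).toNNReal v
        : S →ᵇ ℝ) x :=
    continuous_expect_comp hG (δ • f) x continuous_real_toNNReal
      ((hvc.mul continuous_const).sub hvc)
      fun s => sub_mem (mul_expComp_mem_D hG (G.neg_mem hδf) (hvD s)) (hvD s)
  rw [e1, expect_sub_semigroup_eq_integral hG hδf h, ← intervalIntegral.integral_const_mul,
    ← intervalIntegral.integral_sub ((hQ.const_mul _).intervalIntegrable _ _)
      (hRx.intervalIntegrable _ _)]
  have := intervalIntegral.norm_integral_le_of_norm_le_const (a := (0 : ℝ)) (b := t)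
    (C := ‖δ⁻¹ • (expComp (-(δ • f)) - 1) + f‖ * ‖v‖ + η δ)
    (f := fun s : ℝ => δ⁻¹ * M.expect (M.timeChanged (δ • f)) s.toNNReal
      (M.semigroup (t - s).toNNReal v * expComp (-(δ • f)) - M.semigroup (t - s).toNNReal v
        : S →ᵇ ℝ) x - M.response (M.negMulL f) k s t x) fun s hs => ?_
  · simpa using this
  rw [uIoc_of_le (NNReal.coe_nonneg t)] at hs
  set z := M.semigroup ((t : ℝ) - s).toNNReal v with hz
  have hsT : s.toNNReal ≤ T :=
    (by simpa using Real.toNNReal_le_toNNReal hs.2 : s.toNNReal ≤ t).trans ht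
  have htT : (t : ℝ) ≤ T := NNReal.coe_le_coe.2 ht
  have h1 : |M.expect (M.timeChanged (δ • f)) s.toNNReal (f * z : S →ᵇ ℝ) x
      - M.semigroup s.toNNReal (f * z) x| ≤ η δ :=
    hηF δ (⟨(t : ℝ) - s, ⟨sub_nonneg.2 hs.2, by linarith [hs.1]⟩⟩, ⟨s.toNNReal, hsT⟩, x)
  have h2 := abs_expect_sub_expect_le (M := M) (f := δ • f) s.toNNReal
    (δ⁻¹ • (z * expComp (-(δ • f)) - z)) (-(f * z)) x
  have h3 : ‖δ⁻¹ • (z * expComp (-(δ • f)) - z) - -(f * z)‖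
      ≤ ‖δ⁻¹ • (expComp (-(δ • f)) - 1) + f‖ * ‖v‖ := by
    have e2 : δ⁻¹ • (z * expComp (-(δ • f)) - z) - -(f * z)
        = (δ⁻¹ • (expComp (-(δ • f)) - 1) + f) * z := by
      rw [add_mul, smul_mul_assoc, sub_mul, one_mul, mul_comm z, sub_neg_eq_add]
    rw [e2]
    exact (norm_mul_le _ _).trans
      (mul_le_mul_of_nonneg_left (hT.contractive _ _) (norm_nonneg _))
  rw [expect_smul, expect_neg] at h2
  have e4 : M.response (M.negMulL f) k s t x = -M.semigroup s.toNNReal (f * z) x := by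
    have e5 : -f * z = -(f * z) := by ring
    rw [response_negMulL f h, ← hz, e5, map_neg]
    rfl
  rw [e4, Real.norm_eq_abs]
  rw [abs_le] at *
  constructor <;> linarith [h1.1, h1.2, h2.1, h2.2]

theorem exists_isGeneratorPair_of_mem_hat (hG : M.IsTestAlgebra G) {k : S →ᵇ ℝ}
    (hk : k ∈ M.hat G) : ∃ v, IsGeneratorPair M.semigroup k v := by
  obtain ⟨g, hg, t, rfl⟩ := hk
  obtain ⟨v, -, hv⟩ := hG.exists_isGeneratorPair hg
  exact ⟨_, M.isContractionSemigroup.isGeneratorPair_apply hv t⟩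

theorem isMarkovPerturbation_timeChanged (hG : M.IsTestAlgebra G) {μ₀ : Measure S}
    (hμ₀ : M.IsInvariant M.X μ₀) : M.IsMarkovPerturbation G μ₀ M.timeChanged where
  zero := M.timeChanged_zero
  measurable f _ := M.measurable_timeChanged f
  start f _ := M.timeChanged_start f
  markov f _ := M.timeChanged_markov f
  semigroup_add f _ s t h x :=
    M.expect_timeChanged_add f s t h.continuous.measurable h.norm_coe_le_norm x
  contractive f _ t h x := M.abs_expect_le _ t h x
  map_D f hf t h hh := expect_timeChanged_mem_D hG hf t hh
  strongCont f _ h hh := tendstoUniformly_expect hG f hh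
  invariant f hf := isInvariant_timeChanged hG hμ₀ hf
  generator f hf g hg := by
    obtain ⟨v, hv, hgv⟩ := hG.exists_isGeneratorPair hg
    exact ⟨_, G.mul_mem hv (hG.expComp_mem (G.neg_mem hf)), tendstoUniformly_generator hG hf hgv⟩

end Duhamel

end StrongMarkovProcess

end TimeChange

end

/-! ### The theorem. -/

open TimeChange in
theorem theorem4p1 {S Ω : Type*} [TopologicalSpace S] [PolishSpace S] [MeasurableSpace S]
    [BorelSpace S] [MeasurableSpace Ω] (M : StrongMarkovProcess S Ω)
    (G : Subalgebra ℝ (S →ᵇ ℝ)) (hG : M.IsTestAlgebra G)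
    (μ₀ : Measure S) [IsProbabilityMeasure μ₀] (hμ₀ : M.IsInvariant M.X μ₀) :
    M.HasResponseFunction G μ₀ M.timeChanged M.negMulL where
  perturbation := StrongMarkovProcess.isMarkovPerturbation_timeChanged hG hμ₀
  hat_subset_domain f _ k hk := StrongMarkovProcess.exists_isGeneratorPair_of_mem_hat hG hk
  continuous f _ g hg := by
    obtain ⟨v, -, hv⟩ := hG.exists_isGeneratorPair hg
    have hT := M.isContractionSemigroup
    have e : ∀ s : ℝ≥0, applyOrZero (M.negMulL f) (M.semigroup s g) = -f * M.semigroup s v :=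
      fun s => StrongMarkovProcess.applyOrZero_negMulL f (hT.isGeneratorPair_apply hv s)
    simp only [e]
    exact continuous_const.mul (hT.continuous_orbit hv.2.1)
  integrable f hf k hk t := by
    obtain ⟨v, hv⟩ := StrongMarkovProcess.exists_isGeneratorPair_of_mem_hat hG hk
    exact (StrongMarkovProcess.continuous_response hG hf hv t).intervalIntegrable _ _
  bound f hf k hk T := by
    obtain ⟨v, hv⟩ := StrongMarkovProcess.exists_isGeneratorPair_of_mem_hat hG hk
    exact StrongMarkovProcess.exists_response_bound hG hf hv T
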